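/- Identify $\mathbb R^3$ with the imaginary quaternions via $v\leftrightarrow[0,v]$. For quaternions put $\mathrm{cr}(a,b,c,d)=(a-b)(b-c)^{-1}(c-d)(d-a)^{-1}$, and for $q=|q|\,[\cos\varphi,\,v\sin\varphi]$ with $\|v\|=1$, $\varphi\in[0,\pi)$, put $\sqrt q=\sqrt{|q|}\,[\cos\frac\varphi2,\,v\sin\frac\varphi2]$. For pairwise distinct $a,b,c,d\in\mathbb R^3$ such that $\mathrm{cr}(c,a,b,d)$ is not a negative real number, let $$f(a,b,c,d)=(w+1)^{-1}(wc+b)\in\mathbb H\cup\{\infty\},\qquad w=(b-a)(c-a)^{-1}\sqrt{\mathrm{cr}(c,a,b,d)} .$$ For a discrete curve $\gamma:\mathbb Z\to\mathbb R^3$, write $a,b,c,d$ for $\gamma_{i-1},\gamma_i,\gamma_{i+1},\gamma_{i+2}$. The discrete curvature circle $k_i$ at the edge $\gamma_i\gamma_{i+1}$ is the circle in $\mathbb R^3$ through the four points $f(d,a,b,c)$, $f(a,b,c,d)$, $f(b,c,d,a)$, $f(c,d,a,b)$; its center is $m_i$ and the inverse of its radius is the discrete curvature $\kappa_i$ (with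 $\kappa_i=0$ if there is no such circle). **Theorem.** Let $s:\mathbb R\to\mathbb R^3$ be a space curve of class $C^4$, let $u\in\mathbb R$ with $s'(u)\neq0$, and for real $\varepsilon\ne0$ let $\gamma_k=s(u+(2k-1)\varepsilon)$, $k\in\mathbb Z$. Let $\kappa(u)=\|s'(u)\times s''(u)\|/\|s'(u)\|^3$ be the curvature of $s$ at $u$. Then, for all sufficiently small $\varepsilon\neq0$, the points $\gamma_{-1},\gamma_0,\gamma_1,\gamma_2$ are pairwise distinct and none of the four cross-ratios whose square roots enter the definition of $k_0$ is a negative real number, and, as $\varepsilon\to0$: 1. $\kappa_0=\kappa(u)+O(\varepsilon^2)$; 2. for all sufficiently small $\varepsilon\ne0$ the inserted point $p_{\gamma_0\gamma_1}=f(\gamma_{-1},\gamma_0,\gamma_1,\gamma_2)$ is a point of $\mathbb R^3$, and $p_{\gamma_0\gamma_1}=s(u)+O(\varepsilon^3)$; 3. if $\kappa(u)\neq0$, then for all sufficiently small $\varepsilon\neq0$ there is exactly one circle $k_0$ through the four inserted points, and its center satisfies $m_0=s(u)+\frac1{\kappa(u)}N(u)+O(\varepsilon^2)$, where $N=B\times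 T$ is the unit principal normal, $T=s'/\|s'\|$, $B=(s'\times s'')/\|s'\times s''\|$. -/

import Mathlib

open Filter Topology Asymptotics
open scoped Quaternion

noncomputable section

namespace SpaceCurve

/-- Euclidean three-space. -/
abbrev E3 : Type := EuclideanSpace ℝ (Fin 3)

/-- The vector product of Euclidean three-space. -/
def cross (v w : E3) : E3 := WithLp.toLp 2 (crossProduct (WithLp.ofLp v) (WithLp.ofLp w))

/-- The identification of `ℝ³` with the imaginary quaternions, `v ↦ [0, v]`. -/
def toQuat (v : E3) : ℍ[ℝ] := ⟨0, v 0, v 1, v 2⟩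

/-! ### Smooth curves -/

/-- Curvature of a parametrized space curve, `‖s' × s''‖ / ‖s'‖³`. -/
def curvature (s : ℝ → E3) (u : ℝ) : ℝ :=
  ‖cross (deriv s u) (iteratedDeriv 2 s u)‖ / ‖deriv s u‖ ^ 3

/-- Unit principal normal `N = B × T`, with `B` the unit vector in the direction `s' × s''` and `T`
the unit vector in the direction `s'`. It is meaningful where the curvature is non-zero. -/
def unitNormal (s : ℝ → E3) (u : ℝ) : E3 :=
  cross
    (‖cross (deriv s u) (iteratedDeriv 2 s u)‖⁻¹ • cross (deriv s u) (iteratedDeriv 2 s u))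
    (‖deriv s u‖⁻¹ • deriv s u)

/-- The discrete curve `γ_k = s (u + (2k - 1) ε)`. -/
def sample (s : ℝ → E3) (u ε : ℝ) (k : ℤ) : E3 := s (u + (2 * (k : ℝ) - 1) * ε)

/-! ### The quaternionic insertion rule -/

/-- Quaternionic cross-ratio. -/
def crossRatio (a b c d : ℍ[ℝ]) : ℍ[ℝ] := (a - b) * (b - c)⁻¹ * (c - d) * (d - a)⁻¹

/-- The square root `√|q| [cos (φ/2), v sin (φ/2)]` of `q = |q| [cos φ, v sin φ]`, `‖v‖ = 1`,
`φ ∈ [0, π]`. The direction `v` is irrelevant for `φ = 0`; for `φ = π` (negative reals) the root is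
not determined, and these quaternions are excluded by `Nonsingular` below. -/
def qsqrt (q : ℍ[ℝ]) : ℍ[ℝ] :=
  let φ := Real.arccos (q.re / ‖q‖)
  Real.sqrt ‖q‖ • ((Real.cos (φ / 2) : ℍ[ℝ]) + Real.sin (φ / 2) • (‖q.im‖⁻¹ • q.im))

open Classical in
/-- The point `f(a, b, c, d)` inserted by the quaternionic rule
`((b-a)(c-a)⁻¹ √cr(c,a,b,d) + 1)⁻¹ ((b-a)(c-a)⁻¹ √cr(c,a,b,d) c + b)`; it is `∞` if the first
factor is the inverse of `0`. -/
def insertQuat (a b c d : ℍ[ℝ]) : OnePoint ℍ[ℝ] :=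
  let w := (b - a) * (c - a)⁻¹ * qsqrt (crossRatio c a b d)
  if w + 1 = 0 then OnePoint.infty else OnePoint.some ((w + 1)⁻¹ * (w * c + b))

/-- The insertion rule for points of `ℝ³`. -/
def insertPoint (a b c d : E3) : OnePoint ℍ[ℝ] :=
  insertQuat (toQuat a) (toQuat b) (toQuat c) (toQuat d)

/-- The quaternionic cross-ratio of four points of `ℝ³` is not a negative real number. -/
def CrossRatioNotNeg (a b c d : E3) : Prop :=
  ¬ ∃ t : ℝ, t < 0 ∧ crossRatio (toQuat a) (toQuat b) (toQuat c) (toQuat d) = (t : ℍ[ℝ])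

/-- The four vertices around the edge `γ_i γ_{i+1}` are pairwise distinct, and none of the four
square roots used for that edge is the root of a negative real number. -/
def Nonsingular (γ : ℤ → E3) (i : ℤ) : Prop :=
  let a := γ (i - 1)
  let b := γ i
  let c := γ (i + 1)
  let d := γ (i + 2)
  [a, b, c, d].Nodup ∧
    CrossRatioNotNeg c a b d ∧ CrossRatioNotNeg d b c a ∧
    CrossRatioNotNeg a c d b ∧ CrossRatioNotNeg b d a c

/-! ### The discrete curvature circle -/

/-- A circle in `ℝ³`: center, positive radius, and direction of the plane that contains it. -/
structure Circle3 where
  center : E3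
  radius : ℝ
  direction : Submodule ℝ E3
  radius_pos : 0 < radius
  finrank_direction : Module.finrank ℝ direction = 2

/-- The points of a circle. -/
def Circle3.points (k : Circle3) : Set E3 :=
  {x | x - k.center ∈ k.direction ∧ dist x k.center = k.radius}

/-- An inserted point is (finite, an imaginary quaternion, and) a point of the circle `k`. -/
def Circle3.Contains (k : Circle3) (p : OnePoint ℍ[ℝ]) : Prop :=
  ∃ x ∈ k.points, p = OnePoint.some (toQuat x)

/-- `k` is a discrete curvature circle of `γ` at the edge `γ_i γ_{i+1}`: it passes through the four
inserted points `p_ab`, `p_bc`, `p_cd`, `p_da`, where `a, b, c, d` are `γ_{i-1}, …, γ_{i+2}`. -/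
def IsDiscreteCurvatureCircle (γ : ℤ → E3) (i : ℤ) (k : Circle3) : Prop :=
  let a := γ (i - 1)
  let b := γ i
  let c := γ (i + 1)
  let d := γ (i + 2)
  k.Contains (insertPoint d a b c) ∧ k.Contains (insertPoint a b c d) ∧
    k.Contains (insertPoint b c d a) ∧ k.Contains (insertPoint c d a b)

open Classical in
/-- The discrete curvature at the edge `γ_i γ_{i+1}`, the inverse of the radius of the discrete
curvature circle; it is `0` if there is no such circle (the circle degenerates to a line). -/
def discreteCurvature (γ : ℤ → E3) (i : ℤ) : ℝ :=
  if h : ∃ k, IsDiscreteCurvatureCircle γ i k then h.choose.radius⁻¹ else 0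

open Classical in
/-- The discrete curvature center at the edge `γ_i γ_{i+1}`, the center of the discrete curvature
circle (with the value `0` if there is no such circle). -/
def discreteCenter (γ : ℤ → E3) (i : ℤ) : E3 :=
  if h : ∃ k, IsDiscreteCurvatureCircle γ i k then h.choose.center else 0

end SpaceCurve

end

/-!
Inversion in a sphere conjugates the quaternionic cross-ratio (`crossRatio_add_inv`), so the
insertion rule commutes with inversions. The proof inverts everything at the inserted point
`y = f(a, b, c, d)` itself. In that picture the vertices form a parallelogram `W ± α` (the images of
`a` and `d`), `W ± β` (those of `b` and `c`), see `inv_sub_add_inv_sub`; the three other inserted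
points become `W + γ`, `W - γ` and `W`, where `γ` is a quaternionic geometric mean of `α` and `β`,
a multiple of their bisector (`exists_insertPoint_eq`). Hence the four inserted points lie on the
inverse of the line `W + ℝ γ`. If `F` is the point of this line nearest to the origin, the
discrete curvature is `2 ‖F‖`, the circle exists if and only if `F ≠ 0`, and its center is then
`y + F / (2 ‖F‖²)` (`isDiscreteCurvatureCircle_iff`).

It remains to expand `y` and `F`. With the chords `X_j = (s (u + j ε) - s u) / ε` and
`y = s u + ε ζ`, the parallelogram condition reads
`(X₋₃ - ζ)⁻¹ + (X₃ - ζ)⁻¹ = (X₋₁ - ζ)⁻¹ + (X₁ - ζ)⁻¹`. In the expansion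
`X_j⁻¹ = g₀ / j + ε g₁ + ε² j g₂ + O(ε³)` the coefficient of `ε` is independent of `j` and the other
ones are odd in `j`, so `ζ = 0` satisfies the condition up to `O(ε³)`; its linearization in `ζ` is
invertible, and the solution with `ζ → 0` is therefore `O(ε³)` (`isBigO_of_residual`). By the same
parity, `W` is `g₁` up to the sign of the identification and an error `O(ε²)`, the directions of `α`
and `β` are that of `s'` up to `O(ε²)`, and `2 F`, twice the component of `W` orthogonal to the
bisector, is the curvature vector `κ N` up to `O(ε²)` (`exists_discreteCurvatureCircle`).
-/

noncomputable section

namespace SpaceCurve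

/-! ### Quaternionic square roots -/

theorem norm_sq_eq_re_add_im (q : ℍ[ℝ]) : ‖q‖ ^ 2 = q.re ^ 2 + ‖q.im‖ ^ 2 := by
  have h1 := Quaternion.normSq_eq_norm_mul_self q
  have h2 := Quaternion.normSq_eq_norm_mul_self q.im
  rw [Quaternion.normSq_def'] at h1 h2
  simp only [Quaternion.re_im, Quaternion.imI_im, Quaternion.imJ_im, Quaternion.imK_im] at h2
  nlinarith

theorem abs_re_le_norm (q : ℍ[ℝ]) : |q.re| ≤ ‖q‖ :=
  abs_le_of_sq_le_sq (by nlinarith [norm_sq_eq_re_add_im q, sq_nonneg ‖q.im‖]) (norm_nonneg q)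

/-- Off the closed negative real axis the trigonometric square root is the rational expression
`(q + ‖q‖) / √(2 (Re q + ‖q‖))`, which shows that it is continuous there. -/
theorem qsqrt_eq {q : ℍ[ℝ]} (hq : 0 < q.re + ‖q‖) :
    qsqrt q = (√(2 * (q.re + ‖q‖)))⁻¹ • (q + (‖q‖ : ℍ[ℝ])) := by
  have habs := abs_le.1 (abs_re_le_norm q)
  have hn : 0 < ‖q‖ := by linarith
  have hc : Real.cos (Real.arccos (q.re / ‖q‖)) = q.re / ‖q‖ :=
    Real.cos_arccos ((le_div_iff₀ hn).2 (by linarith)) ((div_le_one hn).2 (by linarith))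
  have h0 := Real.arccos_nonneg (q.re / ‖q‖)
  have hpi := Real.arccos_le_pi (q.re / ‖q‖)
  have hD : 0 < √(2 * (q.re + ‖q‖)) := Real.sqrt_pos.2 (by linarith)
  have hD2 : √(2 * (q.re + ‖q‖)) ^ 2 = 2 * (q.re + ‖q‖) := Real.sq_sqrt (by linarith)
  have hcos : √‖q‖ * Real.cos (Real.arccos (q.re / ‖q‖) / 2)
      = (√(2 * (q.re + ‖q‖)))⁻¹ * (q.re + ‖q‖) := by
    rw [Real.cos_half (by linarith) hpi, hc, ← Real.sqrt_mul hn.le,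
      Real.sqrt_eq_iff_mul_self_eq_of_pos (by positivity)]
    field_simp
    rw [hD2]; field_simp; ring
  have hsin : q.im ≠ 0 → √‖q‖ * Real.sin (Real.arccos (q.re / ‖q‖) / 2) * ‖q.im‖⁻¹
      = (√(2 * (q.re + ‖q‖)))⁻¹ := by
    intro him
    have hi : 0 < ‖q.im‖ := norm_pos_iff.2 him
    have hs : √‖q‖ * Real.sin (Real.arccos (q.re / ‖q‖) / 2)
        = (√(2 * (q.re + ‖q‖)))⁻¹ * ‖q.im‖ := by
      rw [Real.sin_half_eq_sqrt h0 (by linarith), hc, ← Real.sqrt_mul hn.le,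
        Real.sqrt_eq_iff_mul_self_eq_of_pos (by positivity)]
      field_simp
      rw [hD2]
      nlinarith [norm_sq_eq_re_add_im q]
    rw [hs]; field_simp
  have hdec : q + (‖q‖ : ℍ[ℝ]) = ((q.re + ‖q‖ : ℝ) : ℍ[ℝ]) + q.im := by
    ext <;> simp
  rw [hdec]
  simp only [qsqrt]
  rw [smul_add, smul_add, smul_smul, smul_smul]
  congr 1
  · rw [Quaternion.smul_coe, Quaternion.smul_coe, hcos]
  · by_cases him : q.im = 0
    · simp [him]
    · rw [hsin him]

/-- The characteristic equation of a quaternion. -/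
theorem mul_self_sub (q : ℍ[ℝ]) :
    q * q = ((2 * q.re : ℝ) : ℍ[ℝ]) * q - ((‖q‖ ^ 2 : ℝ) : ℍ[ℝ]) := by
  have h := Quaternion.normSq_eq_norm_mul_self q
  rw [← sq, Quaternion.normSq_def'] at h
  generalize ‖q‖ ^ 2 = n at *
  subst h
  rw [Quaternion.coe_mul_eq_smul]
  ext <;> simp only [Quaternion.re_mul, Quaternion.imI_mul, Quaternion.imJ_mul, Quaternion.imK_mul,
    Quaternion.re_sub, Quaternion.imI_sub, Quaternion.imJ_sub, Quaternion.imK_sub,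
    Quaternion.re_smul, Quaternion.imI_smul, Quaternion.imJ_smul, Quaternion.imK_smul,
    Quaternion.re_coe, Quaternion.imI_coe, Quaternion.imJ_coe, Quaternion.imK_coe, smul_eq_mul]
  all_goals ring

theorem re_mul_self (q : ℍ[ℝ]) : (q * q).re = 2 * q.re ^ 2 - ‖q‖ ^ 2 := by
  rw [mul_self_sub, Quaternion.re_sub, Quaternion.re_coe, Quaternion.coe_mul_eq_smul,
    Quaternion.re_smul, smul_eq_mul]
  ring

theorem qsqrt_mul_self {p : ℍ[ℝ]} (hp : 0 < p.re) : qsqrt (p * p) = p := by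
  have hs : (p * p).re + ‖p * p‖ = 2 * p.re ^ 2 := by rw [re_mul_self, norm_mul]; ring
  rw [qsqrt_eq (by rw [hs]; positivity), hs, show 2 * (2 * p.re ^ 2) = (2 * p.re) ^ 2 by ring,
    Real.sqrt_sq (by positivity), norm_mul, ← sq ‖p‖, mul_self_sub, sub_add_cancel,
    Quaternion.coe_mul_eq_smul, smul_smul, inv_mul_cancel₀ (by positivity), one_smul]

theorem qsqrt_mul_qsqrt {q : ℍ[ℝ]} (hq : 0 < q.re + ‖q‖) : qsqrt q * qsqrt q = q := by
  have h : (q + (‖q‖ : ℍ[ℝ])) * (q + (‖q‖ : ℍ[ℝ])) = (2 * (q.re + ‖q‖)) • q := by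
    rw [mul_add, add_mul, add_mul, mul_self_sub, Quaternion.mul_coe_eq_smul,
      Quaternion.coe_mul_eq_smul, Quaternion.coe_mul_eq_smul, Quaternion.coe_mul_eq_smul,
      Quaternion.smul_coe, ← sq]
    module
  rw [qsqrt_eq hq, smul_mul_smul_comm, h, smul_smul, ← mul_inv,
    Real.mul_self_sqrt (by linarith), inv_mul_cancel₀ (by linarith), one_smul]

theorem re_qsqrt_pos {q : ℍ[ℝ]} (hq : 0 < q.re + ‖q‖) : 0 < (qsqrt q).re := by
  rw [qsqrt_eq hq]
  have : 0 < √(2 * (q.re + ‖q‖)) := Real.sqrt_pos.2 (by linarith)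
  simp only [Quaternion.re_smul, Quaternion.re_add, Quaternion.re_coe, smul_eq_mul]
  positivity

theorem tendsto_qsqrt {ι : Type*} {l : Filter ι} {q : ι → ℍ[ℝ]} {t : ℝ} (ht : 0 < t)
    (hq : Tendsto q l (𝓝 ((t ^ 2 : ℝ) : ℍ[ℝ]))) :
    Tendsto (fun i => qsqrt (q i)) l (𝓝 (t : ℍ[ℝ])) := by
  have h0 : 0 < ((t ^ 2 : ℝ) : ℍ[ℝ]).re + ‖((t ^ 2 : ℝ) : ℍ[ℝ])‖ := by
    rw [Quaternion.norm_coe, Quaternion.re_coe, Real.norm_of_nonneg (by positivity)]; positivity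
  have hre : Tendsto (fun i => (q i).re + ‖q i‖) l
      (𝓝 (((t ^ 2 : ℝ) : ℍ[ℝ]).re + ‖((t ^ 2 : ℝ) : ℍ[ℝ])‖)) :=
    ((Quaternion.continuous_re.tendsto _).comp hq).add hq.norm
  have hv : (t : ℍ[ℝ]) = qsqrt ((t ^ 2 : ℝ) : ℍ[ℝ]) := by
    rw [sq, Quaternion.coe_mul, qsqrt_mul_self (by simpa using ht)]
  rw [hv, qsqrt_eq h0]
  have hlim : Tendsto (fun i => (√(2 * ((q i).re + ‖q i‖)))⁻¹ • (q i + (‖q i‖ : ℍ[ℝ]))) l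
      (𝓝 ((√(2 * (((t ^ 2 : ℝ) : ℍ[ℝ]).re + ‖((t ^ 2 : ℝ) : ℍ[ℝ])‖)))⁻¹ •
        (((t ^ 2 : ℝ) : ℍ[ℝ]) + ((‖((t ^ 2 : ℝ) : ℍ[ℝ])‖ : ℝ) : ℍ[ℝ])))) := by
    refine Tendsto.smul (Tendsto.inv₀ ((Real.continuous_sqrt.tendsto _).comp (hre.const_mul 2))
      (Real.sqrt_pos.2 (by linarith)).ne') (hq.add ?_)
    exact (Quaternion.continuous_coe.tendsto _).comp hq.norm
  refine hlim.congr' ?_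
  filter_upwards [hre.eventually (lt_mem_nhds h0)] with i hi
  exact (qsqrt_eq hi).symm

/-- For imaginary `α` and `β = α q` the quaternion `α √q` is again imaginary: it is the vector along
the bisector of `α` and `β` whose length is the geometric mean of theirs. -/
theorem re_mul_qsqrt_eq_zero {α q : ℍ[ℝ]} (hq : 0 < q.re + ‖q‖) (hα : α.re = 0)
    (hαq : (α * q).re = 0) : (α * qsqrt q).re = 0 := by
  have h (n : ℝ) : (α * (q + (n : ℍ[ℝ]))).re = 0 := by
    rw [mul_add, Quaternion.mul_coe_eq_smul, Quaternion.re_add, Quaternion.re_smul, hα, hαq]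
    simp
  rw [qsqrt_eq hq, mul_smul_comm, Quaternion.re_smul, h, smul_zero]

/-! ### The insertion rule and inversions -/

theorem re_mul_comm (p q : ℍ[ℝ]) : (p * q).re = (q * p).re := by
  simp only [Quaternion.re_mul]; ring

theorem re_inv (p : ℍ[ℝ]) : (p⁻¹).re = p.re / ‖p‖ ^ 2 := by
  rw [Quaternion.inv_def, Quaternion.re_smul, Quaternion.re_star, smul_eq_mul,
    Quaternion.normSq_eq_norm_mul_self, ← sq, inv_mul_eq_div]

/-- The inserted point `f = f(a, b, c, d)` is the point with
`cr(c, a, b, f) = -√cr(c, a, b, d)`. -/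
theorem insertQuat_eq_some {a b c d f : ℍ[ℝ]} (hab : a ≠ b) (hac : a ≠ c) (hbc : b ≠ c)
    (hfc : f ≠ c) (hsq : crossRatio c a b f * crossRatio c a b f = crossRatio c a b d)
    (hre : (crossRatio c a b f).re < 0) : insertQuat a b c d = OnePoint.some f := by
  have hca : c - a ≠ 0 := sub_ne_zero.2 hac.symm
  have hab' : a - b ≠ 0 := sub_ne_zero.2 hab
  have hfc' : f - c ≠ 0 := sub_ne_zero.2 hfc
  have hbc' : b - c ≠ 0 := sub_ne_zero.2 hbc
  have hs : qsqrt (crossRatio c a b d) = -crossRatio c a b f := by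
    rw [← hsq, ← neg_mul_neg, qsqrt_mul_self]
    simpa using hre
  have hw : (b - a) * (c - a)⁻¹ * qsqrt (crossRatio c a b d) = (b - f) * (f - c)⁻¹ := by
    rw [hs, crossRatio, ← neg_sub a b]
    simp only [neg_mul, mul_neg, neg_neg, mul_assoc]
    rw [inv_mul_cancel_left₀ hca, mul_inv_cancel_left₀ hab']
  -- hence `(w + 1)⁻¹ (w c + b) = c + (w + 1)⁻¹ (b - c) = f`
  have hw1 : (b - f) * (f - c)⁻¹ + 1 = (b - c) * (f - c)⁻¹ := by
    rw [← sub_add_sub_cancel b f c, add_mul, mul_inv_cancel₀ hfc']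
  have hne : (b - c) * (f - c)⁻¹ ≠ 0 := mul_ne_zero hbc' (inv_ne_zero hfc')
  simp only [insertQuat]
  rw [hw, if_neg (by rwa [hw1])]
  congr 1
  have : (b - f) * (f - c)⁻¹ * c + b = ((b - c) * (f - c)⁻¹) * c + (b - c) := by
    rw [← hw1]; noncomm_ring
  rw [this, mul_add, hw1, inv_mul_cancel_left₀ hne, mul_inv_rev, inv_inv, mul_assoc,
    inv_mul_cancel₀ hbc', mul_one]
  abel

theorem add_inv_sub_add_inv (y : ℍ[ℝ]) {p q : ℍ[ℝ]} (hp : p ≠ 0) (hq : q ≠ 0) :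
    y + p⁻¹ - (y + q⁻¹) = p⁻¹ * (q - p) * q⁻¹ := by
  rw [mul_sub, sub_mul, mul_inv_cancel_right₀ hq, inv_mul_cancel₀ hp, one_mul]; abel

/-- Inversion in a sphere conjugates the cross-ratio. -/
theorem crossRatio_add_inv (y : ℍ[ℝ]) {p q r t : ℍ[ℝ]} (hp : p ≠ 0) (hq : q ≠ 0) (hr : r ≠ 0)
    (ht : t ≠ 0) :
    crossRatio (y + p⁻¹) (y + q⁻¹) (y + r⁻¹) (y + t⁻¹) = p⁻¹ * crossRatio p q r t * p := by
  have e1 : y + q⁻¹ - (y + r⁻¹) = r⁻¹ * (r - q) * q⁻¹ := by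
    rw [← neg_sub, add_inv_sub_add_inv y hr hq]; noncomm_ring
  have e2 : y + t⁻¹ - (y + p⁻¹) = p⁻¹ * (p - t) * t⁻¹ := by
    rw [← neg_sub, add_inv_sub_add_inv y hp ht]; noncomm_ring
  rw [crossRatio, crossRatio, add_inv_sub_add_inv y hp hq, add_inv_sub_add_inv y hr ht, e1, e2,
    ← neg_sub p q, ← neg_sub r t, ← neg_sub q r, ← neg_sub t p]
  simp only [mul_inv_rev, inv_inv, mul_assoc, inv_neg, neg_mul, mul_neg, neg_neg]
  rw [inv_mul_cancel_left₀ hq, mul_inv_cancel_left₀ hr, inv_mul_cancel_left₀ ht]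

/-- The characterization of the inserted point, read after an inversion centered at `y`. -/
theorem insertQuat_add_inv (y : ℍ[ℝ]) {a b c d f : ℍ[ℝ]} (ha : a ≠ 0) (hb : b ≠ 0) (hc : c ≠ 0)
    (hd : d ≠ 0) (hf : f ≠ 0) (hab : a ≠ b) (hac : a ≠ c) (hbc : b ≠ c) (hfc : f ≠ c)
    (hsq : crossRatio c a b f * crossRatio c a b f = crossRatio c a b d)
    (hre : (crossRatio c a b f).re < 0) :
    insertQuat (y + a⁻¹) (y + b⁻¹) (y + c⁻¹) (y + d⁻¹) = OnePoint.some (y + f⁻¹) := by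
  have hne : ∀ {p q : ℍ[ℝ]}, p ≠ q → y + p⁻¹ ≠ y + q⁻¹ := fun h e =>
    h (inv_injective (add_left_cancel e))
  refine insertQuat_eq_some (hne hab) (hne hac) (hne hbc) (hne hfc) ?_ ?_
  · rw [crossRatio_add_inv y hc ha hb hf, crossRatio_add_inv y hc ha hb hd, ← hsq]
    simp only [mul_assoc]
    rw [mul_inv_cancel_left₀ hc]
  · rw [crossRatio_add_inv y hc ha hb hf, mul_assoc, re_mul_comm, mul_assoc, mul_inv_cancel₀ hc,
      mul_one]
    exact hre

/-! ### The four inserted points after inversion at one of them -/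

/-- If the inserted point `y = f(a, b, c, d)` is moved to infinity, the four vertices become a
parallelogram with diagonals `ad` and `bc`. The hypothesis `hs` says that `y` is the inserted point,
solved for the square root `s` of the cross-ratio. -/
theorem inv_sub_add_inv_sub {a b c d y s : ℍ[ℝ]} (hab : a ≠ b) (hac : a ≠ c) (hbc : b ≠ c)
    (hcd : c ≠ d) (hay : a ≠ y) (hby : b ≠ y) (hcy : c ≠ y) (hdy : d ≠ y)
    (hsq : s * s = crossRatio c a b d) (hs : s = (c - a) * (b - a)⁻¹ * ((b - y) * (y - c)⁻¹)) :
    (a - y)⁻¹ + (d - y)⁻¹ = (b - y)⁻¹ + (c - y)⁻¹ := by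
  obtain ⟨A, hA, rfl⟩ : ∃ A, A ≠ 0 ∧ a = y + A⁻¹ :=
    ⟨(a - y)⁻¹, inv_ne_zero (sub_ne_zero.2 hay), by simp⟩
  obtain ⟨B, hB, rfl⟩ : ∃ A, A ≠ 0 ∧ b = y + A⁻¹ :=
    ⟨(b - y)⁻¹, inv_ne_zero (sub_ne_zero.2 hby), by simp⟩
  obtain ⟨C, hC, rfl⟩ : ∃ A, A ≠ 0 ∧ c = y + A⁻¹ :=
    ⟨(c - y)⁻¹, inv_ne_zero (sub_ne_zero.2 hcy), by simp⟩
  obtain ⟨D, hD, rfl⟩ : ∃ A, A ≠ 0 ∧ d = y + A⁻¹ :=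
    ⟨(d - y)⁻¹, inv_ne_zero (sub_ne_zero.2 hdy), by simp⟩
  have hAB : A - B ≠ 0 := fun h => hab (by rw [sub_eq_zero.1 h])
  have hAC : A - C ≠ 0 := fun h => hac (by rw [sub_eq_zero.1 h])
  have hBC : B - C ≠ 0 := fun h => hbc (by rw [sub_eq_zero.1 h])
  have hCD : C - D ≠ 0 := fun h => hcd (by rw [sub_eq_zero.1 h])
  simp only [add_sub_cancel_left, inv_inv]
  -- the value of `-s` is the cross-ratio of `C, A, B, ∞`, up to conjugation by `C`
  have hs' : s = -(C⁻¹ * ((A - C) * (A - B)⁻¹) * C) := by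
    have e : y + B⁻¹ - (y + A⁻¹) = B⁻¹ * (A - B) * A⁻¹ := add_inv_sub_add_inv y hB hA
    have e' : y - (y + C⁻¹) = -C⁻¹ := by abel
    rw [hs, add_inv_sub_add_inv y hC hA, e, e', add_sub_cancel_left]
    simp only [mul_inv_rev, inv_inv, inv_neg, mul_neg, mul_assoc]
    rw [inv_mul_cancel_left₀ hA, mul_inv_cancel_left₀ hB]
  rw [crossRatio_add_inv y hC hA hB hD, hs', crossRatio, neg_mul_neg] at hsq
  simp only [mul_assoc] at hsq
  rw [mul_inv_cancel_left₀ hC, mul_right_inj' (inv_ne_zero hC)] at hsq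
  simp only [← mul_assoc] at hsq
  rw [mul_left_inj' hC, ← neg_sub A C, ← neg_sub C D] at hsq
  simp only [mul_assoc, neg_mul, inv_neg, mul_neg, neg_neg] at hsq
  rw [mul_right_inj' hAC, mul_right_inj' (inv_ne_zero hAB)] at hsq
  have h1 : (B - C) * (A - B)⁻¹ = (A - C) * (A - B)⁻¹ - 1 := by
    rw [← sub_sub_sub_cancel_left C B A, sub_mul, mul_inv_cancel₀ hAB]
  have h2 : (B - C) * (C - D)⁻¹ = (B - D) * (C - D)⁻¹ - 1 := by
    rw [← sub_sub_sub_cancel_right B C D, sub_mul, mul_inv_cancel₀ hCD]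
  have h3 : A - B = C - D := inv_injective (mul_left_cancel₀ hBC (by rw [h1, h2, hsq]))
  rw [← sub_eq_zero] at h3 ⊢
  rw [← h3]; abel

/-- In the parallelogram `W ± α`, `W ± β` the point inserted along the side from `W + α` to
`W + β` is `W + γ` with `γ α⁻¹ γ = β`, so that `γ` is a geometric mean of `α` and `β`. -/
theorem insertQuat_parallelogram_side {y W α β γ : ℍ[ℝ]} (hα : α ≠ 0) (hγ : γ ≠ 0)
    (hγα : γ * α⁻¹ * γ = β) (hWα : W + α ≠ 0) (hWα' : W - α ≠ 0) (hWβ : W + β ≠ 0)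
    (hWβ' : W - β ≠ 0) (hWγ : W + γ ≠ 0) (hαβ : α ≠ β) (hαβ' : α + β ≠ 0)
    (hre : 0 < ((α + β) * γ⁻¹).re) :
    insertQuat (y + (W - α)⁻¹) (y + (W + α)⁻¹) (y + (W + β)⁻¹) (y + (W - β)⁻¹)
      = OnePoint.some (y + (W + γ)⁻¹) := by
  have hβ : β ≠ 0 := by
    rw [← hγα]; exact mul_ne_zero (mul_ne_zero hγ (inv_ne_zero hα)) hγ
  have hγβ : γ ≠ β := by
    rintro rfl
    apply hαβ
    have : γ * α⁻¹ = 1 := mul_right_cancel₀ hγ (by rw [hγα, one_mul])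
    rw [mul_inv_eq_one₀ hα] at this
    exact this.symm
  have hγα' : α - γ ≠ 0 := by
    intro h
    rw [← sub_eq_zero.1 h, mul_inv_cancel₀ hα, one_mul] at hγα
    exact hαβ hγα
  have hab : W - α - (W + α) = (-2 : ℝ) • α := by module
  have hca : W + β - (W - α) = α + β := by abel
  have hmid : (α - γ) * (γ - β)⁻¹ = α * γ⁻¹ := by
    have : γ - β = γ * α⁻¹ * (α - γ) := by
      rw [mul_sub, hγα, mul_assoc, inv_mul_cancel₀ hα, mul_one]
    rw [this, mul_inv_rev, mul_inv_rev, inv_inv, mul_inv_cancel_left₀ hγα']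
  have hcr : crossRatio (W + β) (W - α) (W + α) (W + γ) = (-2 : ℝ)⁻¹ • ((α + β) * γ⁻¹) := by
    rw [crossRatio, hab, hca, add_sub_add_left_eq_sub, add_sub_add_left_eq_sub, mul_assoc, hmid,
      smul_inv₀, mul_smul_comm, smul_mul_assoc, mul_assoc, inv_mul_cancel_left₀ hα]
  refine insertQuat_add_inv y hWα' hWα hWβ hWβ' hWγ ?_ ?_ ?_ ?_ ?_ ?_
  · rw [← sub_ne_zero, hab]; simpa using hα
  · rw [ne_comm, ← sub_ne_zero, hca]; exact hαβ'
  · simpa using hαβ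
  · simpa using hγβ
  · have hbd : W + α - (W - β) = α + β := by abel
    have hdc : W - β - (W + β) = (-2 : ℝ) • β := by module
    have e : γ⁻¹ * (α + β) * γ⁻¹ = α⁻¹ * (α + β) * β⁻¹ := by
      rw [← hγα]
      simp only [mul_add, add_mul, mul_inv_rev, inv_inv, mul_assoc]
      simp only [inv_mul_cancel_left₀ hα, inv_mul_cancel_left₀ hγ,
        mul_inv_cancel_left₀ hγ, mul_inv_cancel₀ hγ, mul_one]
    rw [hcr, crossRatio, hab, hca, hbd, hdc, smul_mul_smul_comm, smul_inv₀, smul_inv₀,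
      mul_smul_comm, mul_smul_comm, smul_mul_assoc, smul_mul_assoc, smul_smul]
    congr 1
    rw [mul_assoc, ← mul_assoc γ⁻¹, e]
    simp only [mul_assoc]
  · rw [hcr, Quaternion.re_smul, smul_eq_mul]
    linarith

/-- In the parallelogram `W ± α`, `W ± β` with `|α| < |β|`, the point inserted between `W - α` and
`W + α` is the center `W`. -/
theorem insertQuat_parallelogram_diagonal {y W α β : ℍ[ℝ]} (hα : α ≠ 0) (hW : W ≠ 0)
    (hWα : W + α ≠ 0) (hWα' : W - α ≠ 0) (hWβ : W + β ≠ 0) (hWβ' : W - β ≠ 0)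
    (hlt : ‖α‖ < ‖β‖) :
    insertQuat (y + (W - β)⁻¹) (y + (W - α)⁻¹) (y + (W + α)⁻¹) (y + (W + β)⁻¹)
      = OnePoint.some (y + W⁻¹) := by
  have hαβ : α - β ≠ 0 := fun h => hlt.ne (by rw [sub_eq_zero.1 h])
  have hαβ' : α + β ≠ 0 := fun h => hlt.ne (by rw [eq_neg_of_add_eq_zero_left h, norm_neg])
  have h1 : W + α - (W - β) = α + β := by abel
  have h2 : W - β - (W - α) = α - β := by abel
  have h3 : W - α - W = -α := by abel
  have h4 : W - (W + α) = -α := by abel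
  have h5 : W - α - (W + β) = -(α + β) := by abel
  have h6 : W + β - (W + α) = -(α - β) := by abel
  have hcr : crossRatio (W + α) (W - β) (W - α) W = (α + β) * (α - β)⁻¹ := by
    rw [crossRatio, h1, h2, h3, h4, mul_inv_cancel_right₀ (neg_ne_zero.2 hα)]
  refine insertQuat_add_inv y hWβ' hWα' hWα hWβ hW ?_ ?_ ?_ ?_ ?_ ?_
  · rwa [← sub_ne_zero, h2]
  · rwa [ne_comm, ← sub_ne_zero, h1]
  · rw [← sub_ne_zero, sub_add_eq_sub_sub, h3]
    have : -α - α = (-2 : ℝ) • α := by module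
    rw [this]; simpa using hα
  · rw [← sub_ne_zero, h4]; exact neg_ne_zero.2 hα
  · rw [hcr, crossRatio, h1, h2, h5, h6, inv_neg, mul_neg, mul_neg, neg_mul, neg_neg]
    simp only [mul_assoc]
  · rw [hcr, Quaternion.inv_def, mul_smul_comm, Quaternion.re_smul, ← Quaternion.inner_def,
      inner_add_left, inner_sub_right, inner_sub_right, real_inner_comm α β,
      real_inner_self_eq_norm_sq, real_inner_self_eq_norm_sq, smul_eq_mul]
    refine mul_neg_of_pos_of_neg (inv_pos.2 ?_) ?_
    · rw [Quaternion.normSq_eq_norm_mul_self]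
      have := norm_pos_iff.2 hαβ
      positivity
    · nlinarith [norm_nonneg α]

/-- The inserted point is imaginary when the four vertices are. -/
theorem re_insert_eq_zero {a b c d s y : ℍ[ℝ]} (hab : a ≠ b) (hac : a ≠ c) (hbc : b ≠ c)
    (hcd : c ≠ d) (ha : a.re = 0) (hb : b.re = 0) (hc : c.re = 0) (hd : d.re = 0)
    (hq : 0 < (crossRatio c a b d).re + ‖crossRatio c a b d‖)
    (hs : s = qsqrt (crossRatio c a b d)) 
    (hy : y = ((b - a) * (c - a)⁻¹ * s + 1)⁻¹ * ((b - a) * (c - a)⁻¹ * s * c + b))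
    (hw : (b - a) * (c - a)⁻¹ * s + 1 ≠ 0) :
    y.re = 0 := by
  have hca : c - a ≠ 0 := sub_ne_zero.2 hac.symm
  have hbc' : b - c ≠ 0 := sub_ne_zero.2 hbc
  have hab' : a - b ≠ 0 := sub_ne_zero.2 hab
  have hdc : d - c ≠ 0 := sub_ne_zero.2 hcd.symm
  have him : ∀ {p q : ℍ[ℝ]}, p.re = 0 → q.re = 0 → ((p - q)⁻¹).re = 0 := fun hp hq => by
    rw [re_inv]; simp [hp, hq]
  have hyc : y - c = ((b - a) * (c - a)⁻¹ * s + 1)⁻¹ * (b - c) := by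
    have : (b - a) * (c - a)⁻¹ * s * c + b = ((b - a) * (c - a)⁻¹ * s + 1) * c + (b - c) := by
      noncomm_ring
    rw [hy, this, mul_add, inv_mul_cancel_left₀ hw]; abel
  have h1 : (b - c)⁻¹ * (b - a) * (c - a)⁻¹ = (c - a)⁻¹ + (b - c)⁻¹ := by
    rw [← sub_add_sub_cancel b c a, mul_add, add_mul, inv_mul_cancel₀ hbc', one_mul, mul_assoc,
      mul_inv_cancel₀ hca, mul_one]
  have h2 : (b - c)⁻¹ * (b - a) * (c - a)⁻¹ * crossRatio c a b d = (b - c)⁻¹ - (d - c)⁻¹ := by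
    rw [crossRatio, ← neg_sub a b, ← sub_sub_sub_cancel_right b d c]
    simp only [mul_neg, neg_mul, mul_assoc]
    rw [inv_mul_cancel_left₀ hca, mul_inv_cancel_left₀ hab', sub_mul, mul_inv_cancel₀ hdc, mul_sub,
      inv_mul_cancel_left₀ hbc']
    noncomm_ring
  have h3 : ((y - c)⁻¹).re = 0 := by
    rw [hyc, mul_inv_rev, inv_inv, mul_add, mul_one, ← mul_assoc, ← mul_assoc, Quaternion.re_add,
      him hb hc, add_zero, hs]
    refine re_mul_qsqrt_eq_zero hq ?_ ?_
    · rw [h1, Quaternion.re_add, him hc ha, him hb hc, add_zero]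
    · rw [h2, Quaternion.re_sub, him hb hc, him hd hc, sub_zero]
  -- the inverse of an imaginary quaternion is imaginary
  have h4 : (y - c).re = 0 := by
    have := re_inv (y - c)⁻¹
    rw [inv_inv, h3, zero_div] at this
    exact this
  rw [← sub_add_cancel y c, Quaternion.re_add, h4, hc, add_zero]

/-! ### Three-space and the imaginary quaternions -/

theorem toQuat_re (v : E3) : (toQuat v).re = 0 := rfl

theorem toQuat_imI (v : E3) : (toQuat v).imI = v 0 := rfl

theorem toQuat_imJ (v : E3) : (toQuat v).imJ = v 1 := rfl

theorem toQuat_imK (v : E3) : (toQuat v).imK = v 2 := rfl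

theorem toQuat_add (v w : E3) : toQuat (v + w) = toQuat v + toQuat w := by
  ext <;> simp [toQuat_re, toQuat_imI, toQuat_imJ, toQuat_imK]

theorem toQuat_sub (v w : E3) : toQuat (v - w) = toQuat v - toQuat w := by
  ext <;> simp [toQuat_re, toQuat_imI, toQuat_imJ, toQuat_imK]

theorem toQuat_smul (r : ℝ) (v : E3) : toQuat (r • v) = r • toQuat v := by
  ext <;> simp [toQuat_re, toQuat_imI, toQuat_imJ, toQuat_imK]

theorem toQuat_zero : toQuat 0 = 0 := by
  ext <;> simp [toQuat]

theorem toQuat_injective : Function.Injective toQuat := by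
  intro v w h
  have h1 := congrArg QuaternionAlgebra.imI h
  have h2 := congrArg QuaternionAlgebra.imJ h
  have h3 := congrArg QuaternionAlgebra.imK h
  ext i
  fin_cases i
  · exact h1
  · exact h2
  · exact h3

theorem exists_toQuat_eq {p : ℍ[ℝ]} (hp : p.re = 0) : ∃ v : E3, toQuat v = p := by
  refine ⟨!₂[p.imI, p.imJ, p.imK], ?_⟩
  ext <;> simp [toQuat, hp]

theorem norm_toQuat (v : E3) : ‖toQuat v‖ = ‖v‖ := by
  rw [EuclideanSpace.norm_eq, eq_comm, Real.sqrt_eq_iff_mul_self_eq (by positivity) (by positivity),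
    ← Quaternion.normSq_eq_norm_mul_self, Quaternion.normSq_def', Fin.sum_univ_three]
  simp [toQuat]

theorem toQuat_eq_zero {v : E3} : toQuat v = 0 ↔ v = 0 := by
  rw [← toQuat_zero, toQuat_injective.eq_iff]

/-- The inversion in the unit sphere, `v ↦ v / ‖v‖²`, with the value `0` at `0`. Under the
identification with the imaginary quaternions it is `q ↦ -q⁻¹`. -/
def invert (v : E3) : E3 := (‖v‖ ^ 2)⁻¹ • v

theorem inv_toQuat (v : E3) : (toQuat v)⁻¹ = -toQuat (invert v) := by
  rw [Quaternion.inv_def, Quaternion.normSq_eq_norm_mul_self, norm_toQuat, invert, toQuat_smul,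
    ← smul_neg, ← sq]
  congr 1
  ext <;> simp [toQuat_re, toQuat_imI, toQuat_imJ, toQuat_imK]

theorem inv_neg_toQuat (v : E3) : (-toQuat v)⁻¹ = toQuat (invert v) := by
  rw [inv_neg, inv_toQuat, neg_neg]

/-! ### Circles through a point, as inverses of lines -/

theorem norm_invert (v : E3) : ‖invert v‖ = ‖v‖⁻¹ := by
  rcases eq_or_ne v 0 with rfl | h
  · simp [invert]
  · have := norm_pos_iff.2 h
    rw [invert, norm_smul, norm_inv, norm_pow, norm_norm]
    field_simp

theorem norm_sub_eq_norm_iff (v n : E3) : ‖v - n‖ = ‖n‖ ↔ ‖v‖ ^ 2 = 2 * inner ℝ v n := by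
  rw [← sq_eq_sq₀ (norm_nonneg _) (norm_nonneg _), norm_sub_sq_real]
  constructor <;> intro h <;> linarith

/-- The inverse of `v` lies on the sphere around `n` through the origin if and only if `v` lies in
the plane `⟨v, n⟩ = 1/2`. -/
theorem norm_invert_sub_eq_norm_iff {v : E3} (hv : v ≠ 0) (n : E3) :
    ‖invert v - n‖ = ‖n‖ ↔ 2 * inner ℝ v n = 1 := by
  have := norm_pos_iff.2 hv
  rw [norm_sub_eq_norm_iff, norm_invert, invert, real_inner_smul_left, inv_pow]
  field_simp
  exact eq_comm

/-- The circle through `Y` that is the inverse, in the unit sphere around `Y`, of the line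
`F + ℝ γ` whose point nearest to the origin is `F`. -/
def circleOfLine (Y : E3) {F γ : E3} (hF : F ≠ 0) (hγ : γ ≠ 0) (h : inner ℝ F γ = 0) :
    Circle3 where
  center := Y + (1 / 2 : ℝ) • invert F
  radius := (2 * ‖F‖)⁻¹
  direction := Submodule.span ℝ {F, γ}
  radius_pos := by have := norm_pos_iff.2 hF; positivity
  finrank_direction := by
    have hli : LinearIndependent ℝ ![F, γ] := by
      rw [LinearIndependent.pair_iff]
      intro p q hpq
      have h1 : inner ℝ (p • F + q • γ) F = (0 : ℝ) := by rw [hpq, inner_zero_left]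
      have h2 : inner ℝ (p • F + q • γ) γ = (0 : ℝ) := by rw [hpq, inner_zero_left]
      rw [inner_add_left, real_inner_smul_left, real_inner_smul_left, real_inner_comm F γ, h] at h1
      rw [inner_add_left, real_inner_smul_left, real_inner_smul_left, h] at h2
      constructor
      · simpa [hF] using h1
      · simpa [hγ] using h2
    have := finrank_span_eq_card hli
    rwa [Matrix.range_cons, Matrix.range_cons, Matrix.range_empty, Set.union_empty,
      Set.singleton_union, Fintype.card_fin] at this

theorem norm_half_invert {F : E3} : ‖(1 / 2 : ℝ) • invert F‖ = (2 * ‖F‖)⁻¹ := by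
  rw [norm_smul, norm_invert, mul_inv]; norm_num

theorem base_mem_circleOfLine (Y : E3) {F γ : E3} (hF : F ≠ 0) (hγ : γ ≠ 0)
    (h : inner ℝ F γ = 0) : Y ∈ (circleOfLine Y hF hγ h).points := by
  constructor
  · simp only [circleOfLine, invert, smul_smul, sub_add_cancel_left]
    exact neg_mem (Submodule.smul_mem _ _ (Submodule.subset_span (by simp)))
  · simp only [circleOfLine]
    rw [dist_self_add_right, norm_half_invert]

theorem add_invert_mem_circleOfLine (Y : E3) {F γ : E3} (hF : F ≠ 0) (hγ : γ ≠ 0)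
    (h : inner ℝ F γ = 0) (t : ℝ) :
    Y + invert (F + t • γ) ∈ (circleOfLine Y hF hγ h).points := by
  have hF' : F ∈ Submodule.span ℝ {F, γ} := Submodule.subset_span (by simp)
  have hγ' : γ ∈ Submodule.span ℝ {F, γ} := Submodule.subset_span (by simp)
  constructor
  · simp only [circleOfLine, invert, smul_smul, add_sub_add_left_eq_sub]
    exact sub_mem (Submodule.smul_mem _ _ (add_mem hF' (Submodule.smul_mem _ _ hγ')))
      (Submodule.smul_mem _ _ hF')
  · have hFF : inner ℝ F F ≠ (0 : ℝ) := inner_self_ne_zero.2 hF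
    have hne : F + t • γ ≠ 0 := by
      intro h0
      have h1 : inner ℝ (F + t • γ) F = (0 : ℝ) := by rw [h0, inner_zero_left]
      rw [inner_add_left, real_inner_smul_left, real_inner_comm F γ, h, mul_zero, add_zero] at h1
      exact hFF h1
    simp only [circleOfLine]
    rw [dist_eq_norm, add_sub_add_left_eq_sub, ← norm_half_invert,
      norm_invert_sub_eq_norm_iff hne, invert, real_inner_smul_right, real_inner_smul_right,
      inner_add_left, real_inner_smul_left, real_inner_comm F γ, h, mul_zero, add_zero,
      ← real_inner_self_eq_norm_sq]
    field_simp

theorem circle_ext {k k' : Circle3} (h1 : k.center = k'.center) (h2 : k.radius = k'.radius)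
    (h3 : k.direction = k'.direction) : k = k' := by
  cases k; cases k'; simp only at h1 h2 h3; subst h1 h2 h3; rfl

/-- Three points determine a circle: if a circle passes through `Y` and through the inverses of two
points of the line `F + ℝ γ`, the line avoids the origin and the circle is the inverse of the
line. -/
theorem eq_circleOfLine {k : Circle3} {Y F γ : E3} (hγ : γ ≠ 0) (h : inner ℝ F γ = 0) {t t' : ℝ}
    (ht : t ≠ t') (hL : F + t • γ ≠ 0) (hL' : F + t' • γ ≠ 0) (hY : Y ∈ k.points)
    (hk : Y + invert (F + t • γ) ∈ k.points) (hk' : Y + invert (F + t' • γ) ∈ k.points) :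
    ∃ hF : F ≠ 0, k = circleOfLine Y hF hγ h := by
  obtain ⟨n, hn⟩ : ∃ n, k.center = Y + n := ⟨k.center - Y, by abel⟩
  have hnd : n ∈ k.direction := by
    have := hY.1
    rw [hn, sub_add_cancel_left] at this
    simpa using neg_mem this
  have hnr : ‖n‖ = k.radius := by
    have := hY.2
    rwa [hn, dist_self_add_right] at this
  -- with center `Y + n`, the circle passes through `Y + invert L` only if `⟨L, n⟩ = 1/2`
  have key : ∀ L : E3, L ≠ 0 → Y + invert L ∈ k.points →
      L ∈ k.direction ∧ 2 * inner ℝ L n = 1 := by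
    intro L hL0 hmem
    obtain ⟨h1, h2⟩ := hmem
    rw [hn, add_sub_add_left_eq_sub] at h1
    rw [hn, dist_eq_norm, add_sub_add_left_eq_sub, ← hnr, norm_invert_sub_eq_norm_iff hL0] at h2
    refine ⟨?_, h2⟩
    have h3 : invert L ∈ k.direction := by simpa using add_mem h1 hnd
    have h4 : L = (‖L‖ ^ 2) • invert L := by
      have := norm_pos_iff.2 hL0
      rw [invert, smul_smul, mul_inv_cancel₀ (by positivity), one_smul]
    rw [h4]
    exact Submodule.smul_mem _ _ h3
  obtain ⟨hd, hi⟩ := key _ hL hk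
  obtain ⟨hd', hi'⟩ := key _ hL' hk'
  have htt : t - t' ≠ 0 := sub_ne_zero.2 ht
  have hγd : γ ∈ k.direction := by
    have h1 : γ = (t - t')⁻¹ • (F + t • γ - (F + t' • γ)) := by
      rw [add_sub_add_left_eq_sub, ← sub_smul, smul_smul, inv_mul_cancel₀ htt, one_smul]
    rw [h1]
    exact Submodule.smul_mem _ _ (sub_mem hd hd')
  have hFd : F ∈ k.direction := by
    simpa using sub_mem hd (Submodule.smul_mem _ t hγd)
  rw [inner_add_left, real_inner_smul_left] at hi hi'
  have hγn : inner ℝ γ n = (0 : ℝ) := by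
    have : (t - t') * inner ℝ γ n = (0 : ℝ) := by linarith
    exact (mul_eq_zero.1 this).resolve_left htt
  have hFn : 2 * inner ℝ F n = (1 : ℝ) := by rw [hγn] at hi; linarith
  have hF : F ≠ 0 := by
    rintro rfl
    rw [inner_zero_left] at hFn
    norm_num at hFn
  have hdir : Submodule.span ℝ {F, γ} = k.direction := by
    refine Submodule.eq_of_le_of_finrank_eq ?_ ?_
    · rw [Submodule.span_le]
      intro x hx
      rcases hx with rfl | rfl
      · exact hFd
      · exact hγd
    · rw [k.finrank_direction]
      exact (circleOfLine Y hF hγ h).finrank_direction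
  have hnF : n = (1 / 2 : ℝ) • invert F := by
    rw [← hdir, Submodule.mem_span_pair] at hnd
    obtain ⟨p, q, rfl⟩ := hnd
    rw [inner_add_right, real_inner_smul_right, real_inner_smul_right] at hγn hFn
    rw [real_inner_comm, h, mul_zero, zero_add] at hγn
    rw [h, mul_zero, add_zero, real_inner_self_eq_norm_sq] at hFn
    have hq : q = 0 := (mul_eq_zero.1 hγn).resolve_right (inner_self_ne_zero.2 hγ)
    have hpos := norm_pos_iff.2 hF
    have hp : p = 1 / 2 * (‖F‖ ^ 2)⁻¹ := by field_simp; linarith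
    rw [hq, zero_smul, add_zero, invert, smul_smul, hp]
  refine ⟨hF, circle_ext ?_ ?_ hdir.symm⟩
  · rw [hn, hnF]; rfl
  · rw [← hnr, hnF, norm_half_invert]; rfl

/-! ### The discrete curvature circle of a fixed curve -/

/-- The point of the line `w + ℝ d` nearest to the origin. -/
def foot (w d : E3) : E3 := w - (inner ℝ w d / inner ℝ d d) • d

theorem inner_foot (w : E3) {d : E3} (hd : d ≠ 0) : inner ℝ (foot w d) d = 0 := by
  have : inner ℝ d d ≠ (0 : ℝ) := inner_self_ne_zero.2 hd
  rw [foot, inner_sub_left, real_inner_smul_left, div_mul_cancel₀ _ this, sub_self]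

theorem foot_smul (w d : E3) {r : ℝ} (hr : r ≠ 0) : foot w (r • d) = foot w d := by
  rcases eq_or_ne d 0 with rfl | hd
  · simp
  have : inner ℝ d d ≠ (0 : ℝ) := inner_self_ne_zero.2 hd
  rw [foot, foot, real_inner_smul_right, real_inner_smul_right, real_inner_smul_left, smul_smul]
  congr 2
  field_simp

theorem inner_toQuat (v w : E3) : inner ℝ (toQuat v) (toQuat w) = inner ℝ v w := by
  rw [real_inner_eq_norm_mul_self_add_norm_mul_self_sub_norm_sub_mul_self_div_two,
    real_inner_eq_norm_mul_self_add_norm_mul_self_sub_norm_sub_mul_self_div_two, ← toQuat_sub,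
    norm_toQuat, norm_toQuat, norm_toQuat]

/-- A vector in the direction of the bisector of two vectors, zero if they point in
opposite directions. -/
def bisector (α β : E3) : E3 := ‖α‖ • β + ‖β‖ • α

/-- Two vectors at an acute angle have a quaternionic geometric mean along their bisector. -/
theorem exists_geometric_mean {α β : E3} (h : 0 < inner ℝ α β) :
    ∃ r : ℝ, 0 < r ∧ bisector α β ≠ 0 ∧
      toQuat (r • bisector α β) * (toQuat α)⁻¹ * toQuat (r • bisector α β) = toQuat β ∧
      0 < ((toQuat α + toQuat β) * (toQuat (r • bisector α β))⁻¹).re := by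
  have hα : α ≠ 0 := by rintro rfl; simp at h
  have hα' : toQuat α ≠ 0 := toQuat_eq_zero.not.2 hα
  have hn : 0 < ‖α‖ := norm_pos_iff.2 hα
  have hnq : ‖(toQuat α)⁻¹ * toQuat β‖ = ‖β‖ / ‖α‖ := by
    rw [norm_mul, norm_inv, norm_toQuat, norm_toQuat, inv_mul_eq_div]
  have hre : 0 < ((toQuat α)⁻¹ * toQuat β).re := by
    rw [re_mul_comm, Quaternion.inv_def, mul_smul_comm, Quaternion.re_smul,
      ← Quaternion.inner_def, inner_toQuat, real_inner_comm, Quaternion.normSq_eq_norm_mul_self,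
      norm_toQuat, smul_eq_mul]
    positivity
  generalize hqdef : (toQuat α)⁻¹ * toQuat β = q at hnq hre
  have hq : 0 < q.re + ‖q‖ := by positivity
  have hαq : toQuat α * q = toQuat β := by rw [← hqdef, mul_inv_cancel_left₀ hα']
  have hr : 0 < √(2 * (q.re + ‖q‖)) := Real.sqrt_pos.2 (by linarith)
  have hγ : toQuat (((√(2 * (q.re + ‖q‖)))⁻¹ * ‖α‖⁻¹) • bisector α β) = toQuat α * qsqrt q := by
    have e : toQuat α * (q + (‖q‖ : ℍ[ℝ])) = toQuat (‖α‖⁻¹ • bisector α β) := by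
      rw [mul_add, hαq, Quaternion.mul_coe_eq_smul, hnq, bisector, toQuat_smul, toQuat_add,
        toQuat_smul, toQuat_smul, smul_add, smul_smul, smul_smul, inv_mul_cancel₀ hn.ne',
        one_smul, inv_mul_eq_div]
    rw [qsqrt_eq hq, mul_smul_comm, e, mul_smul, toQuat_smul]
  have hs := re_qsqrt_pos hq
  have hs0 : qsqrt q ≠ 0 := by intro h0; rw [h0] at hs; simp at hs
  refine ⟨(√(2 * (q.re + ‖q‖)))⁻¹ * ‖α‖⁻¹, by positivity, ?_, ?_, ?_⟩
  · intro h0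
    rw [h0, smul_zero, toQuat_zero] at hγ
    exact mul_ne_zero hα' hs0 hγ.symm
  · rw [hγ, mul_assoc, inv_mul_cancel_left₀ hα', mul_assoc, qsqrt_mul_qsqrt hq, hαq]
  · have e : (toQuat α)⁻¹ * (toQuat α + toQuat β) * (qsqrt q)⁻¹ = (qsqrt q)⁻¹ + qsqrt q := by
      have e' : q * (qsqrt q)⁻¹ = qsqrt q := by
        rw [mul_inv_eq_iff_eq_mul₀ hs0, qsqrt_mul_qsqrt hq]
      rw [mul_add, inv_mul_cancel₀ hα', hqdef, add_mul, one_mul, e']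
    rw [hγ, mul_inv_rev, ← mul_assoc, re_mul_comm, ← mul_assoc, e, Quaternion.re_add, re_inv]
    positivity

theorem invert_invert (v : E3) : invert (invert v) = v := by
  rcases eq_or_ne v 0 with rfl | h
  · simp [invert]
  · have := norm_pos_iff.2 h
    rw [invert, norm_invert, invert, smul_smul]
    field_simp
    exact one_smul ℝ v

theorem contains_some_toQuat {k : Circle3} {x : E3} :
    k.Contains (OnePoint.some (toQuat x)) ↔ x ∈ k.points := by
  constructor
  · rintro ⟨z, hz, h⟩
    rw [toQuat_injective (OnePoint.coe_injective h)]
    exact hz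
  · exact fun h => ⟨x, h, rfl⟩

theorem bisector_ne_zero {α β : E3} (h : 0 < inner ℝ α β) : bisector α β ≠ 0 := by
  obtain ⟨-, -, hne, -⟩ := exists_geometric_mean h
  exact hne

/-- The inserted points in `ℝ³`: after the inversion centered at `Y` the vertices are `W ± α` and
`W ± β`, two of the inserted points lie symmetrically to `W` on the bisector of `α` and `β`, and the
third one is `W`. -/
theorem exists_insertPoint_eq {Y W α β : E3} (hW : ‖W‖ < ‖α‖) (hlt : ‖α‖ < ‖β‖)
    (hin : 0 < inner ℝ α β) :
    ∃ r : ℝ, r ≠ 0 ∧ W + r • bisector α β ≠ 0 ∧ W - r • bisector α β ≠ 0 ∧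
      insertPoint (Y + invert (W - α)) (Y + invert (W + α)) (Y + invert (W + β))
        (Y + invert (W - β)) = OnePoint.some (toQuat (Y + invert (W + r • bisector α β))) ∧
      insertPoint (Y + invert (W + β)) (Y + invert (W - β)) (Y + invert (W - α))
        (Y + invert (W + α)) = OnePoint.some (toQuat (Y + invert (W - r • bisector α β))) ∧
      (W ≠ 0 → insertPoint (Y + invert (W - β)) (Y + invert (W - α)) (Y + invert (W + α))
        (Y + invert (W + β)) = OnePoint.some (toQuat (Y + invert W))) := by
  obtain ⟨r, hr, hδ, hmean, hre⟩ := exists_geometric_mean hin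
  have hα : α ≠ 0 := by rintro rfl; simp at hin
  have hβ : β ≠ 0 := by rintro rfl; simp at hin
  generalize hγdef : r • bisector α β = γ at hmean hre
  have hγ : γ ≠ 0 := by rw [← hγdef]; exact smul_ne_zero hr.ne' hδ
  have hnα := norm_pos_iff.2 hα
  have hnγ : ‖γ‖ * ‖γ‖ = ‖α‖ * ‖β‖ := by
    have := congrArg norm hmean
    rw [norm_mul, norm_mul, norm_inv, norm_toQuat, norm_toQuat, norm_toQuat] at this
    field_simp at this
    linarith
  have hαγ : ‖α‖ < ‖γ‖ := by nlinarith [norm_nonneg γ]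
  have hne : ∀ {v : E3}, ‖W‖ < ‖v‖ → W + v ≠ 0 ∧ W - v ≠ 0 := fun hv =>
    ⟨fun h => hv.ne (by rw [eq_neg_of_add_eq_zero_left h, norm_neg]),
      fun h => hv.ne (by rw [sub_eq_zero.1 h])⟩
  have hq : ∀ {v : E3}, v ≠ 0 → -toQuat v ≠ 0 := fun hv => neg_ne_zero.2 (toQuat_eq_zero.not.2 hv)
  obtain ⟨h1, h2⟩ := hne hW
  obtain ⟨h3, h4⟩ := hne (hW.trans hlt)
  obtain ⟨h5, h6⟩ := hne (hW.trans hαγ)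
  -- `invert` is `q ↦ (-q)⁻¹` on imaginary quaternions, so that the quaternionic lemmas are applied
  -- to the negatives of `W`, `α`, `β`, `γ`
  have hadd : ∀ v : E3, -toQuat W + -toQuat v = -toQuat (W + v) := fun v => by
    rw [toQuat_add]; abel
  have hsub : ∀ v : E3, -toQuat W - -toQuat v = -toQuat (W - v) := fun v => by
    rw [toQuat_sub]; abel
  have hαβ : α ≠ β := fun h => hlt.ne (by rw [h])
  have hαβ' : α + β ≠ 0 := fun h => hlt.ne (by rw [eq_neg_of_add_eq_zero_left h, norm_neg])
  refine ⟨r, hr.ne', by rwa [hγdef], by rwa [hγdef], ?_, ?_, fun hW0 => ?_⟩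
  · have := insertQuat_parallelogram_side (y := toQuat Y) (W := -toQuat W) (α := -toQuat α)
      (β := -toQuat β) (γ := -toQuat γ) (hq hα) (hq hγ)
      (by rw [← hmean, inv_neg]; simp only [mul_neg, neg_mul, neg_neg])
      (by rw [hadd]; exact hq h1) (by rw [hsub]; exact hq h2) (by rw [hadd]; exact hq h3)
      (by rw [hsub]; exact hq h4) (by rw [hadd]; exact hq h5)
      (by simpa [toQuat_injective.eq_iff] using hαβ)
      (by rw [← neg_add, ← toQuat_add]; exact hq hαβ')
      (by rw [← neg_add, inv_neg, neg_mul_neg]; exact hre)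
    simp only [hadd, hsub, inv_neg_toQuat, ← toQuat_add] at this
    rw [hγdef]
    exact this
  · have hmean' : toQuat γ * (toQuat β)⁻¹ * toQuat γ = toQuat α := by
      have hγq : toQuat γ ≠ 0 := toQuat_eq_zero.not.2 hγ
      rw [← hmean, mul_inv_rev, mul_inv_rev, inv_inv, mul_inv_cancel_left₀ hγq,
        inv_mul_cancel_right₀ hγq]
    -- the parallelogram with `α` and `β` replaced by `-β` and `-α`, and the mean by `-γ`
    have := insertQuat_parallelogram_side (y := toQuat Y) (W := -toQuat W) (α := toQuat β)
      (β := toQuat α) (γ := toQuat γ) (toQuat_eq_zero.not.2 hβ) (toQuat_eq_zero.not.2 hγ) hmean'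
      (by rw [← sub_neg_eq_add, hsub]; exact hq h4)
      (by rw [sub_eq_add_neg, hadd]; exact hq h3)
      (by rw [← sub_neg_eq_add, hsub]; exact hq h2)
      (by rw [sub_eq_add_neg, hadd]; exact hq h1)
      (by rw [← sub_neg_eq_add, hsub]; exact hq h6)
      (toQuat_injective.ne hαβ.symm)
      (by rw [add_comm, ← toQuat_add]; exact toQuat_eq_zero.not.2 hαβ')
      (by rw [add_comm]; exact hre)
    have hsub' : ∀ v : E3, -toQuat W + toQuat v = -toQuat (W - v) := fun v => by
      rw [toQuat_sub]; abel
    have hadd' : ∀ v : E3, -toQuat W - toQuat v = -toQuat (W + v) := fun v => by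
      rw [toQuat_add]; abel
    simp only [hadd', hsub', inv_neg_toQuat, ← toQuat_add] at this
    rw [hγdef]
    exact this
  · have := insertQuat_parallelogram_diagonal (y := toQuat Y) (W := -toQuat W) (α := -toQuat α)
      (β := -toQuat β) (hq hα) (hq hW0)
      (by rw [hadd]; exact hq h1) (by rw [hsub]; exact hq h2) (by rw [hadd]; exact hq h3)
      (by rw [hsub]; exact hq h4) (by simpa only [norm_neg, norm_toQuat] using hlt)
    simp only [hadd, hsub, inv_neg_toQuat, ← toQuat_add] at this
    exact this

/-- After an inversion centered at the inserted point `Y = f(a, b, c, d)`, where the vertices are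
`W ± α` and `W ± β`, the discrete curvature circle is the line through `W` along the bisector of
`α` and `β`. The circle exists exactly if this line avoids the origin. The condition `‖W‖ < ‖α‖`
keeps the images of the vertices and of two inserted points off the origin, and `‖α‖ < ‖β‖` selects
the branch of the root for which the fourth inserted point is mapped to `W`. -/
theorem isDiscreteCurvatureCircle_iff {Γ : ℤ → E3} {Y W α β : E3}
    (ha : Γ (-1) = Y + invert (W + α)) (hb : Γ 0 = Y + invert (W + β))
    (hc : Γ 1 = Y + invert (W - β)) (hd : Γ 2 = Y + invert (W - α))
    (hY : insertPoint (Γ (-1)) (Γ 0) (Γ 1) (Γ 2) = OnePoint.some (toQuat Y))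
    (hW : ‖W‖ < ‖α‖) (hlt : ‖α‖ < ‖β‖) (hin : 0 < inner ℝ α β)
    (hδ : bisector α β ≠ 0) (k : Circle3) :
    IsDiscreteCurvatureCircle Γ 0 k ↔ ∃ hF : foot W (bisector α β) ≠ 0,
      k = circleOfLine Y hF hδ (inner_foot W hδ) := by
  obtain ⟨r, hr, hp, hm, h1, h2, h3⟩ := exists_insertPoint_eq (Y := Y) hW hlt hin
  generalize bisector α β = δ at *
  have hline : ∀ t : ℝ, W + t • δ = foot W δ + (inner ℝ W δ / inner ℝ δ δ + t) • δ := fun t => by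
    rw [foot]; module
  have hline' : W - r • δ = foot W δ + (inner ℝ W δ / inner ℝ δ δ + -r) • δ := by
    rw [← hline, neg_smul, sub_eq_add_neg]
  have hiff : IsDiscreteCurvatureCircle Γ 0 k ↔
      k.Contains (insertPoint (Γ 2) (Γ (-1)) (Γ 0) (Γ 1)) ∧
      k.Contains (insertPoint (Γ (-1)) (Γ 0) (Γ 1) (Γ 2)) ∧
      k.Contains (insertPoint (Γ 0) (Γ 1) (Γ 2) (Γ (-1))) ∧
      k.Contains (insertPoint (Γ 1) (Γ 2) (Γ (-1)) (Γ 0)) := Iff.rfl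
  rw [hiff, hY, ha, hb, hc, hd, h1, h2, contains_some_toQuat, contains_some_toQuat,
    contains_some_toQuat]
  rw [hline] at hp ⊢
  rw [hline'] at hm ⊢
  constructor
  · rintro ⟨k1, k2, k3, -⟩
    refine eq_circleOfLine hδ (inner_foot W hδ) ?_ hp hm k2 k1 k3
    intro h
    exact hr (by linarith)
  · rintro ⟨hF, rfl⟩
    refine ⟨add_invert_mem_circleOfLine _ _ _ _ _, base_mem_circleOfLine _ _ _ _,
      add_invert_mem_circleOfLine _ _ _ _ _, ?_⟩
    have hW0 : W ≠ 0 := by rintro rfl; simp [foot] at hF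
    have hW' : W = foot W δ + (inner ℝ W δ / inner ℝ δ δ) • δ := by rw [foot]; module
    rw [h3 hW0, contains_some_toQuat]
    nth_rewrite 3 [hW']
    exact add_invert_mem_circleOfLine _ _ _ _ _

/-- The formula covers the degenerate case: for `F = 0` there is no circle, and both sides are
`0`. -/
theorem discreteCurvature_eq {Γ : ℤ → E3} {Y F δ : E3} (hδ : δ ≠ 0) (h : inner ℝ F δ = 0)
    (hk : ∀ k, IsDiscreteCurvatureCircle Γ 0 k ↔ ∃ hF : F ≠ 0, k = circleOfLine Y hF hδ h) :
    discreteCurvature Γ 0 = 2 * ‖F‖ := by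
  unfold discreteCurvature
  split_ifs with hex
  · obtain ⟨hF, e⟩ := (hk _).1 hex.choose_spec
    rw [e, circleOfLine, inv_inv]
  · by_contra hne
    have hF : F ≠ 0 := by rintro rfl; simp at hne
    exact hex ⟨_, (hk _).2 ⟨hF, rfl⟩⟩

theorem existsUnique_isDiscreteCurvatureCircle {Γ : ℤ → E3} {Y F δ : E3} (hF : F ≠ 0) (hδ : δ ≠ 0)
    (h : inner ℝ F δ = 0)
    (hk : ∀ k, IsDiscreteCurvatureCircle Γ 0 k ↔ ∃ hF : F ≠ 0, k = circleOfLine Y hF hδ h) :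
    ∃! k, IsDiscreteCurvatureCircle Γ 0 k :=
  ⟨circleOfLine Y hF hδ h, (hk _).2 ⟨hF, rfl⟩, fun _ hk' => ((hk _).1 hk').2⟩

theorem discreteCenter_eq {Γ : ℤ → E3} {Y F δ : E3} (hF : F ≠ 0) (hδ : δ ≠ 0) (h : inner ℝ F δ = 0)
    (hk : ∀ k, IsDiscreteCurvatureCircle Γ 0 k ↔ ∃ hF : F ≠ 0, k = circleOfLine Y hF hδ h) :
    discreteCenter Γ 0 = Y + (1 / 2 : ℝ) • invert F := by
  have hex : ∃ k, IsDiscreteCurvatureCircle Γ 0 k := ⟨_, (hk _).2 ⟨hF, rfl⟩⟩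
  unfold discreteCenter
  rw [dif_pos hex]
  obtain ⟨_, e⟩ := (hk _).1 hex.choose_spec
  rw [e, circleOfLine]

/-! ### Expansions in the quaternions -/

theorem isBigO_pow_of_le {m n : ℕ} (h : m ≤ n) :
    (fun ε : ℝ => ε ^ n) =O[𝓝[≠] 0] (fun ε : ℝ => ε ^ m) := by
  rcases h.eq_or_lt with rfl | h
  · exact isBigO_refl _ _
  · exact (isLittleO_pow_pow h).isBigO.mono nhdsWithin_le_nhds

theorem tendsto_of_expansion {E : Type*} [NormedAddCommGroup E] [NormedSpace ℝ E] {P : ℝ → E}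
    {p₀ p₁ p₂ : E}
    (h : (fun ε => P ε - (p₀ + ε • p₁ + ε ^ 2 • p₂)) =O[𝓝[≠] 0] (fun ε : ℝ => ε ^ 3)) :
    Tendsto P (𝓝[≠] 0) (𝓝 p₀) := by
  have h1 : Tendsto (fun ε : ℝ => p₀ + ε • p₁ + ε ^ 2 • p₂) (𝓝[≠] 0) (𝓝 p₀) := by
    have : Continuous (fun ε : ℝ => p₀ + ε • p₁ + ε ^ 2 • p₂) := by fun_prop
    have := this.tendsto 0
    simp only [zero_smul, add_zero, ne_eq, OfNat.ofNat_ne_zero, not_false_eq_true, zero_pow] at this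
    exact this.mono_left nhdsWithin_le_nhds
  have h2 : Tendsto (fun ε : ℝ => ε ^ 3) (𝓝[≠] 0) (𝓝 0) := by
    have : Continuous (fun ε : ℝ => ε ^ 3) := by fun_prop
    simpa using (this.tendsto 0).mono_left nhdsWithin_le_nhds
  simpa using (h.trans_tendsto h2).add h1

/-- The Neumann series of the inverse, up to third order. -/
theorem inv_expansion {P : ℝ → ℍ[ℝ]} {p₀ p₁ p₂ : ℍ[ℝ]} (hp : p₀ ≠ 0)
    (h : (fun ε => P ε - (p₀ + ε • p₁ + ε ^ 2 • p₂)) =O[𝓝[≠] 0] (fun ε : ℝ => ε ^ 3)) :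
    (fun ε => (P ε)⁻¹ - (p₀⁻¹ + ε • -(p₀⁻¹ * p₁ * p₀⁻¹) +
      ε ^ 2 • (p₀⁻¹ * p₁ * p₀⁻¹ * p₁ * p₀⁻¹ - p₀⁻¹ * p₂ * p₀⁻¹)))
      =O[𝓝[≠] 0] (fun ε : ℝ => ε ^ 3) := by
  obtain ⟨t₁, ht₁⟩ : ∃ t, t = -(p₀⁻¹ * p₁ * p₀⁻¹) := ⟨_, rfl⟩
  obtain ⟨t₂, ht₂⟩ : ∃ t, t = p₀⁻¹ * p₁ * p₀⁻¹ * p₁ * p₀⁻¹ - p₀⁻¹ * p₂ * p₀⁻¹ := ⟨_, rfl⟩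
  rw [← ht₁, ← ht₂]
  have e0 : p₀ * p₀⁻¹ = 1 := mul_inv_cancel₀ hp
  have e1 : p₀ * t₁ + p₁ * p₀⁻¹ = 0 := by
    rw [ht₁, mul_neg, mul_assoc, mul_inv_cancel_left₀ hp, neg_add_cancel]
  have e2 : p₀ * t₂ + p₁ * t₁ + p₂ * p₀⁻¹ = 0 := by
    rw [ht₁, ht₂]
    simp only [mul_sub, mul_neg, mul_assoc]
    rw [mul_inv_cancel_left₀ hp, mul_inv_cancel_left₀ hp]
    abel
  have hcont : ∀ f : ℝ → ℍ[ℝ], Continuous f → f =O[𝓝[≠] 0] (fun _ => (1 : ℝ)) := fun f hf =>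
    ((hf.tendsto 0).mono_left nhdsWithin_le_nhds).isBigO_one ℝ
  -- the claimed expansion is a right inverse of `P` up to third order
  have hPT : (fun ε => P ε * (p₀⁻¹ + ε • t₁ + ε ^ 2 • t₂) - 1) =O[𝓝[≠] 0]
      (fun ε : ℝ => ε ^ 3) := by
    have hT := hcont (fun ε => p₀⁻¹ + ε • t₁ + ε ^ 2 • t₂) (by fun_prop)
    have hR := hcont (fun ε => p₁ * t₂ + p₂ * t₁ + ε • (p₂ * t₂)) (by fun_prop)
    have h1 := h.mul hT
    have h2 := (isBigO_refl (fun ε : ℝ => ε ^ 3) (𝓝[≠] 0)).smul hR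
    simp only [mul_one, smul_eq_mul] at h1 h2
    refine (h1.add h2).congr_left fun ε => ?_
    have : (p₀ + ε • p₁ + ε ^ 2 • p₂) * (p₀⁻¹ + ε • t₁ + ε ^ 2 • t₂) - 1
        = ε ^ 3 • (p₁ * t₂ + p₂ * t₁ + ε • (p₂ * t₂)) := by
      simp only [mul_add, add_mul, smul_mul_assoc, mul_smul_comm, smul_add, smul_smul, e0]
      have e1' := congrArg (fun z => ε • z) e1
      have e2' := congrArg (fun z => ε ^ 2 • z) e2
      simp only [smul_add, smul_zero] at e1' e2'
      rw [← sub_eq_zero]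
      have := congrArg₂ (· + ·) e1' e2'
      simp only [add_zero] at this
      rw [← this]
      module
    rw [← this, sub_mul]
    abel
  have hPlim := tendsto_of_expansion h
  have hPinv := (hPlim.inv₀ hp).isBigO_one ℝ
  have h3 := (hPinv.mul hPT).neg_left
  simp only [one_mul] at h3
  refine h3.congr' ?_ EventuallyEq.rfl
  filter_upwards [hPlim.eventually_ne hp] with ε hε
  rw [mul_sub, inv_mul_cancel_left₀ hε, mul_one, neg_sub]

theorem isLittleO_conj {ι : Type*} {l : Filter ι} {U V ζ : ι → ℍ[ℝ]} {u v : ℍ[ℝ]}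
    (hU : Tendsto U l (𝓝 u)) (hV : Tendsto V l (𝓝 v)) :
    (fun i => U i * ζ i * V i - u * ζ i * v) =o[l] (fun i => ‖ζ i‖) := by
  have hU' : (fun i => U i - u) =o[l] (fun _ => (1 : ℝ)) := by
    rw [isLittleO_one_iff]; simpa using hU.sub_const u
  have hV' : (fun i => V i - v) =o[l] (fun _ => (1 : ℝ)) := by
    rw [isLittleO_one_iff]; simpa using hV.sub_const v
  have hζ : ζ =O[l] (fun i => ‖ζ i‖) := (isBigO_refl ζ l).norm_right
  have h1 := (hU'.mul_isBigO hζ).mul_isBigO (hV.isBigO_one ℝ)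
  have h2 := ((isBigO_const_const u (one_ne_zero (α := ℝ)) l).mul hζ).mul_isLittleO hV'
  simp only [one_mul, mul_one] at h1 h2
  refine (h1.add h2).congr_left fun i => ?_
  noncomm_ring

theorem tendsto_inv_smul {ι : Type*} {l : Filter ι} {X : ι → ℍ[ℝ]} {x : ℍ[ℝ]} {j : ℝ} (hj : j ≠ 0)
    (hx : x ≠ 0) (hX : Tendsto X l (𝓝 (j • x))) :
    Tendsto (fun i => (X i)⁻¹) l (𝓝 (j⁻¹ • x⁻¹)) := by
  rw [← smul_inv₀]
  exact hX.inv₀ (smul_ne_zero hj hx)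

/-- Stability of the solution of the equation of `inv_sub_add_inv_sub`: for vertices close to
`-3x, -x, x, 3x`, the small solution `ζ` is bounded by the residual of the equation at `0`. -/
theorem isBigO_of_residual {ι : Type*} {l : Filter ι} {X₁ X₂ X₃ X₄ ζ : ι → ℍ[ℝ]} {x : ℍ[ℝ]}
    {g : ι → ℝ} (hx : x ≠ 0) (h₁ : Tendsto X₁ l (𝓝 ((-3 : ℝ) • x)))
    (h₂ : Tendsto X₂ l (𝓝 ((-1 : ℝ) • x))) (h₃ : Tendsto X₃ l (𝓝 ((1 : ℝ) • x)))
    (h₄ : Tendsto X₄ l (𝓝 ((3 : ℝ) • x))) (hζ : Tendsto ζ l (𝓝 0))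
    (heq : ∀ᶠ i in l, (X₁ i - ζ i)⁻¹ + (X₄ i - ζ i)⁻¹ = (X₂ i - ζ i)⁻¹ + (X₃ i - ζ i)⁻¹)
    (hres : (fun i => (X₁ i)⁻¹ + (X₄ i)⁻¹ - ((X₂ i)⁻¹ + (X₃ i)⁻¹)) =O[l] g) : ζ =O[l] g := by
  have key : ∀ {X : ι → ℍ[ℝ]} {j : ℝ}, j ≠ 0 → Tendsto X l (𝓝 (j • x)) →
      (fun i => (X i - ζ i)⁻¹ - (X i)⁻¹ - (j⁻¹ ^ 2) • (x⁻¹ * ζ i * x⁻¹)) =o[l]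
        (fun i => ‖ζ i‖) := by
    intro X j hj hX
    have hXζ : Tendsto (fun i => X i - ζ i) l (𝓝 (j • x)) := by simpa using hX.sub hζ
    refine (isLittleO_conj (ζ := ζ) (tendsto_inv_smul hj hx hXζ)
      (tendsto_inv_smul hj hx hX)).congr' ?_ EventuallyEq.rfl
    filter_upwards [hX.eventually_ne (smul_ne_zero hj hx),
      hXζ.eventually_ne (smul_ne_zero hj hx)] with i hi hi'
    have e : (X i - ζ i)⁻¹ * ζ i * (X i)⁻¹ = (X i - ζ i)⁻¹ - (X i)⁻¹ := by
      nth_rewrite 2 [← sub_sub_cancel (X i) (ζ i)]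
      rw [mul_sub, inv_mul_cancel₀ hi', sub_mul, one_mul, mul_inv_cancel_right₀ hi]
    rw [e, smul_mul_assoc, smul_mul_assoc, mul_smul_comm, smul_smul, sq]
  have ho := ((key (by norm_num) h₁).add (key (by norm_num) h₄)).sub
    ((key (by norm_num) h₂).add (key (by norm_num) h₃))
  -- the linearization at `ζ = 0` is `ζ ↦ (2/9 - 2) x⁻¹ ζ x⁻¹`
  have hlin : (fun i => (16 / 9 : ℝ) • (x⁻¹ * ζ i * x⁻¹) -
      ((X₁ i)⁻¹ + (X₄ i)⁻¹ - ((X₂ i)⁻¹ + (X₃ i)⁻¹))) =o[l] (fun i => ‖ζ i‖) := by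
    refine ho.congr' ?_ EventuallyEq.rfl
    filter_upwards [heq] with i hi
    rw [eq_sub_of_add_eq hi]
    module
  have hmul : ∀ {f : ι → ℍ[ℝ]} {k : ι → ℝ}, f =O[l] k → (fun i => x * f i * x) =O[l] k := by
    intro f k hf
    have := ((isBigO_const_const x (one_ne_zero (α := ℝ)) l).mul hf).mul
      (isBigO_const_const x (one_ne_zero (α := ℝ)) l)
    simpa using this
  have hmul' : ∀ {f : ι → ℍ[ℝ]} {k : ι → ℝ}, f =o[l] k → (fun i => x * f i * x) =o[l] k := by
    intro f k hf
    have := ((isBigO_const_const x (one_ne_zero (α := ℝ)) l).mul_isLittleO hf).mul_isBigO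
      (isBigO_const_const x (one_ne_zero (α := ℝ)) l)
    simpa using this
  have h5 := ((hmul' hlin).const_smul_left (9 / 16 : ℝ)).of_norm_right.right_isBigO_sub
  refine h5.trans ((hmul hres).const_smul_left (9 / 16 : ℝ) |>.congr_left fun i => ?_)
  have e : x * (x⁻¹ * ζ i * x⁻¹) * x = ζ i := by
    simp only [mul_assoc]
    rw [mul_inv_cancel_left₀ hx, inv_mul_cancel₀ hx, mul_one]
  simp only [Pi.smul_apply]
  rw [mul_sub x (_ • _), sub_mul, mul_smul_comm, smul_mul_assoc, e, smul_sub, smul_smul]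
  norm_num

theorem inv_sub_isBigO {ι : Type*} {l : Filter ι} {X ζ : ι → ℍ[ℝ]} {x : ℍ[ℝ]} {g : ι → ℝ}
    (hx : x ≠ 0) (hX : Tendsto X l (𝓝 x)) (hζ : Tendsto ζ l (𝓝 0)) (hζg : ζ =O[l] g) :
    (fun i => (X i - ζ i)⁻¹ - (X i)⁻¹) =O[l] g := by
  have hXζ : Tendsto (fun i => X i - ζ i) l (𝓝 x) := by simpa using hX.sub hζ
  have h := (((hXζ.inv₀ hx).isBigO_one ℝ).mul hζg).mul ((hX.inv₀ hx).isBigO_one ℝ)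
  simp only [one_mul, mul_one] at h
  refine h.congr' ?_ EventuallyEq.rfl
  filter_upwards [hX.eventually_ne hx, hXζ.eventually_ne hx] with i hi hi'
  nth_rewrite 2 [← sub_sub_cancel (X i) (ζ i)]
  rw [mul_sub, inv_mul_cancel₀ hi', sub_mul, one_mul, mul_inv_cancel_right₀ hi]

/-! ### Cross-ratios of four nearly collinear points -/

theorem crossRatio_add_smul (v p q r t : ℍ[ℝ]) {ε : ℝ} (hε : ε ≠ 0) :
    crossRatio (v + ε • p) (v + ε • q) (v + ε • r) (v + ε • t) = crossRatio p q r t := by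
  simp only [crossRatio, add_sub_add_left_eq_sub, ← smul_sub, smul_inv₀, smul_mul_assoc,
    mul_smul_comm, smul_smul]
  have : ε⁻¹ * (ε * (ε⁻¹ * ε)) = 1 := by field_simp
  rw [this, one_smul]

theorem tendsto_crossRatio {ι : Type*} {l : Filter ι} {P Q R T : ι → ℍ[ℝ]} {x : ℍ[ℝ]}
    {p q r t : ℝ} (hx : x ≠ 0) (hqr : q ≠ r) (htp : t ≠ p) (hP : Tendsto P l (𝓝 (p • x)))
    (hQ : Tendsto Q l (𝓝 (q • x))) (hR : Tendsto R l (𝓝 (r • x)))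
    (hT : Tendsto T l (𝓝 (t • x))) :
    Tendsto (fun i => crossRatio (P i) (Q i) (R i) (T i)) l
      (𝓝 (((p - q) * (q - r)⁻¹ * (r - t) * (t - p)⁻¹ : ℝ) : ℍ[ℝ])) := by
  have h := (((hP.sub hQ).mul ((hQ.sub hR).inv₀ ?_)).mul (hR.sub hT)).mul ((hT.sub hP).inv₀ ?_)
  · convert! h using 2
    simp only [← sub_smul, smul_inv₀, smul_mul_assoc, mul_smul_comm, smul_smul,
      mul_inv_cancel₀ hx, mul_inv_cancel_right₀ hx]
    rw [← mul_one (Quaternion.coe _), Quaternion.coe_mul_eq_smul]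
    congr 1
    ring
  · rw [← sub_smul]; exact smul_ne_zero (sub_ne_zero.2 hqr) hx
  · rw [← sub_smul]; exact smul_ne_zero (sub_ne_zero.2 htp) hx

/-! ### Chords of the curve -/

/-- Taylor expansion to third order; the coefficient `x₃` is never needed explicitly. -/
theorem exists_taylor {s : ℝ → E3} (hs : ContDiff ℝ 4 s) (u : ℝ) :
    ∃ x₃ : E3, (fun h => s (u + h) - s u - (h • deriv s u +
      h ^ 2 • ((1 / 2 : ℝ) • iteratedDeriv 2 s u) + h ^ 3 • x₃)) =O[𝓝 0] (fun h : ℝ => h ^ 4) := by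
  refine ⟨(1 / 6 : ℝ) • iteratedDeriv 3 s u, ?_⟩
  have h1 := (taylor_isLittleO_univ (x₀ := u) (n := 4) (by exact_mod_cast hs)).isBigO
  have hlim : Tendsto (fun h : ℝ => u + h) (𝓝 0) (𝓝 u) := by
    have : Continuous fun h : ℝ => u + h := by fun_prop
    simpa using this.tendsto 0
  have h2 := h1.comp_tendsto hlim
  simp only [Function.comp_def, add_sub_cancel_left, taylor_within_apply, Finset.sum_range_succ,
    Finset.sum_range_zero, iteratedDerivWithin_univ] at h2
  have h3 : (fun h : ℝ => h ^ 4 • ((1 / 24 : ℝ) • iteratedDeriv 4 s u)) =O[𝓝 0]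
      (fun h : ℝ => h ^ 4) := by
    have := (isBigO_refl (fun h : ℝ => h ^ 4) (𝓝 0)).smul
      (isBigO_const_const ((1 / 24 : ℝ) • iteratedDeriv 4 s u) (one_ne_zero (α := ℝ)) (𝓝 0))
    simpa using this
  refine (h2.add h3).congr_left fun h => ?_
  simp only [iteratedDeriv_zero, iteratedDeriv_one, Nat.factorial]
  norm_num
  module

/-- The chord of `s` from `u` to `u + j ε`, divided by `ε`, with the value `0` at `ε = 0`. -/
def chord (s : ℝ → E3) (u j ε : ℝ) : E3 := ε⁻¹ • (s (u + j * ε) - s u)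

theorem add_smul_chord (s : ℝ → E3) (u j : ℝ) {ε : ℝ} (hε : ε ≠ 0) :
    s u + ε • chord s u j ε = s (u + j * ε) := by
  rw [chord, smul_smul, mul_inv_cancel₀ hε, one_smul]; abel

theorem isBigO_toQuat_iff {ι : Type*} {l : Filter ι} {f : ι → E3} {g : ι → ℝ} :
    (fun i => toQuat (f i)) =O[l] g ↔ f =O[l] g := by
  rw [← isBigO_norm_left, ← isBigO_norm_left (f' := f)]
  simp only [norm_toQuat]

theorem chord_expansion {s : ℝ → E3} {u : ℝ} {x₁ x₂ x₃ : E3}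
    (h : (fun h => s (u + h) - s u - (h • x₁ + h ^ 2 • x₂ + h ^ 3 • x₃)) =O[𝓝 0]
      (fun h : ℝ => h ^ 4)) (j : ℝ) :
    (fun ε => toQuat (chord s u j ε) - (j • toQuat x₁ + ε • j ^ 2 • toQuat x₂ +
      ε ^ 2 • j ^ 3 • toQuat x₃)) =O[𝓝[≠] 0] (fun ε : ℝ => ε ^ 3) := by
  have hlim : Tendsto (fun ε : ℝ => j * ε) (𝓝[≠] 0) (𝓝 0) := by
    have : Continuous fun ε : ℝ => j * ε := by fun_prop
    simpa using (this.tendsto 0).mono_left nhdsWithin_le_nhds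
  have h1 := (isBigO_refl (fun ε : ℝ => ε⁻¹) (𝓝[≠] 0)).smul (h.comp_tendsto hlim)
  have h2 : (fun ε : ℝ => ε⁻¹ • ((fun h : ℝ => h ^ 4) ∘ fun ε => j * ε) ε) =O[𝓝[≠] 0]
      (fun ε : ℝ => ε ^ 3) := by
    refine ((isBigO_refl (fun ε : ℝ => ε ^ 3) (𝓝[≠] 0)).const_mul_left (j ^ 4)).congr' ?_
      EventuallyEq.rfl
    filter_upwards [self_mem_nhdsWithin] with ε hε
    have hε' : ε ≠ 0 := hε
    simp only [Function.comp, smul_eq_mul]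
    field_simp
  have h3 := h1.trans h2
  rw [← isBigO_toQuat_iff] at h3
  refine h3.congr' ?_ EventuallyEq.rfl
  filter_upwards [self_mem_nhdsWithin] with ε hε
  have hε' : ε ≠ 0 := hε
  simp only [Function.comp, chord, toQuat_smul, toQuat_sub, toQuat_add, smul_sub, smul_add,
    smul_smul]
  congr 2
  · congr 1
    · congr 1; field_simp
    · congr 1; field_simp
  · congr 1; field_simp

/-- Expansion of the inverted chords. The coefficient of `ε` does not depend on `j`, and that of `ε²`
is odd in `j`: both facts make the quantities below accurate to second order. -/
theorem exists_inv_chord_expansion {s : ℝ → E3} {u : ℝ} {x₁ x₂ x₃ : E3} (hx : x₁ ≠ 0)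
    (h : (fun h => s (u + h) - s u - (h • x₁ + h ^ 2 • x₂ + h ^ 3 • x₃)) =O[𝓝 0]
      (fun h : ℝ => h ^ 4)) :
    ∃ g : ℍ[ℝ], ∀ j : ℝ, j ≠ 0 → (fun ε => (toQuat (chord s u j ε))⁻¹ -
      (j⁻¹ • (toQuat x₁)⁻¹ + ε • -((toQuat x₁)⁻¹ * toQuat x₂ * (toQuat x₁)⁻¹) +
      ε ^ 2 • j • g)) =O[𝓝[≠] 0] (fun ε : ℝ => ε ^ 3) := by
  have hx' : toQuat x₁ ≠ 0 := toQuat_eq_zero.not.2 hx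
  refine ⟨(toQuat x₁)⁻¹ * toQuat x₂ * (toQuat x₁)⁻¹ * toQuat x₂ * (toQuat x₁)⁻¹ -
    (toQuat x₁)⁻¹ * toQuat x₃ * (toQuat x₁)⁻¹, fun j hj => ?_⟩
  refine (inv_expansion (smul_ne_zero hj hx') (chord_expansion h j)).congr_left fun ε => ?_
  simp only [smul_inv₀, smul_mul_assoc, mul_smul_comm, smul_smul, smul_sub]
  have e1 : j⁻¹ * (j ^ 2 * j⁻¹) = 1 := by field_simp
  have e2 : j⁻¹ * (j ^ 2 * 1) = j := by field_simp
  have e3 : j⁻¹ * (j ^ 3 * j⁻¹) = j := by field_simp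
  simp only [e1, e2, e3, one_smul]

/-! ### The inserted point near a line -/

theorem insertQuat_add_smul (v : ℍ[ℝ]) {a b c d f : ℍ[ℝ]} {ε : ℝ} (hε : ε ≠ 0)
    (h : insertQuat a b c d = OnePoint.some f) :
    insertQuat (v + ε • a) (v + ε • b) (v + ε • c) (v + ε • d) = OnePoint.some (v + ε • f) := by
  simp only [insertQuat] at h ⊢
  rw [crossRatio_add_smul v c a b d hε, add_sub_add_left_eq_sub, add_sub_add_left_eq_sub,
    ← smul_sub, ← smul_sub, smul_inv₀, smul_mul_smul_comm, mul_inv_cancel₀ hε, one_smul]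
  generalize (b - a) * (c - a)⁻¹ * qsqrt (crossRatio c a b d) = w at *
  split_ifs at h ⊢ with hw
  · exact absurd h (OnePoint.infty_ne_coe _)
  congr 1
  rw [← OnePoint.coe_injective h]
  have : w * (v + ε • c) + (v + ε • b) = (w + 1) * v + ε • (w * c + b) := by
    rw [mul_add, mul_smul_comm, add_mul, one_mul, smul_add]; abel
  rw [this, mul_add, inv_mul_cancel_left₀ hw, mul_smul_comm]

/-- For four points of `ℝ³` close to `-3x, -x, x, 3x` the inserted point is close to `0`, and it
solves the equation of `inv_sub_add_inv_sub`. -/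
theorem exists_insertPoint_tendsto {ι : Type*} {l : Filter ι} [l.NeBot] {A B C D : ι → E3}
    {x : ℍ[ℝ]} (hx : x ≠ 0) (hA : Tendsto (fun i => toQuat (A i)) l (𝓝 ((-3 : ℝ) • x)))
    (hB : Tendsto (fun i => toQuat (B i)) l (𝓝 ((-1 : ℝ) • x)))
    (hC : Tendsto (fun i => toQuat (C i)) l (𝓝 ((1 : ℝ) • x)))
    (hD : Tendsto (fun i => toQuat (D i)) l (𝓝 ((3 : ℝ) • x))) :
    ∃ ζ : ι → E3, Tendsto (fun i => toQuat (ζ i)) l (𝓝 0) ∧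
      ∀ᶠ i in l, insertPoint (A i) (B i) (C i) (D i) = OnePoint.some (toQuat (ζ i)) ∧
        (toQuat (A i) - toQuat (ζ i))⁻¹ + (toQuat (D i) - toQuat (ζ i))⁻¹
          = (toQuat (B i) - toQuat (ζ i))⁻¹ + (toQuat (C i) - toQuat (ζ i))⁻¹ := by
  obtain ⟨q, hq⟩ : ∃ q : ι → ℍ[ℝ], q = fun i =>
    crossRatio (toQuat (C i)) (toQuat (A i)) (toQuat (B i)) (toQuat (D i)) := ⟨_, rfl⟩
  obtain ⟨w, hw⟩ : ∃ w : ι → ℍ[ℝ], w = fun i => (toQuat (B i) - toQuat (A i)) *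
    (toQuat (C i) - toQuat (A i))⁻¹ * qsqrt (q i) := ⟨_, rfl⟩
  obtain ⟨z, hz⟩ : ∃ z : ι → ℍ[ℝ], z = fun i => (w i + 1)⁻¹ *
    (w i * toQuat (C i) + toQuat (B i)) := ⟨_, rfl⟩
  -- the limits are those of the points `-3, -1, 1, 3` of a line: `q → 4`, `w → 1`, `z → 0`
  have hqlim : Tendsto q l (𝓝 (((2 : ℝ) ^ 2 : ℝ) : ℍ[ℝ])) := by
    have := tendsto_crossRatio hx (by norm_num) (by norm_num) hC hA hB hD
    rw [hq]
    convert! this using 3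
    norm_num
  have hslim : Tendsto (fun i => qsqrt (q i)) l (𝓝 ((2 : ℝ) : ℍ[ℝ])) :=
    tendsto_qsqrt (by norm_num) hqlim
  have hwlim : Tendsto w l (𝓝 1) := by
    have h := ((hB.sub hA).mul ((hC.sub hA).inv₀ ?_)).mul hslim
    · rw [hw]
      convert! h using 2
      rw [← sub_smul, ← sub_smul, smul_inv₀, smul_mul_smul_comm, mul_inv_cancel₀ hx,
        Quaternion.mul_coe_eq_smul, smul_smul]
      norm_num
    · rw [← sub_smul]; exact smul_ne_zero (by norm_num) hx
  have htwo : (2 : ℍ[ℝ]) ≠ 0 := by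
    intro h
    have : (2 : ℝ) = 0 := congrArg QuaternionAlgebra.re h
    norm_num at this
  have hw1lim : Tendsto (fun i => w i + 1) l (𝓝 2) := by
    have := hwlim.add_const 1
    rwa [one_add_one_eq_two] at this
  have hzlim : Tendsto z l (𝓝 0) := by
    have h := (hw1lim.inv₀ htwo).mul ((hwlim.mul hC).add hB)
    rw [hz]
    convert! h using 2
    rw [one_mul, ← add_smul]
    norm_num
  have hsep : ∀ {P Q : ι → E3} {p r : ℝ}, p ≠ r → Tendsto (fun i => toQuat (P i)) l (𝓝 (p • x)) →
      Tendsto (fun i => toQuat (Q i)) l (𝓝 (r • x)) → ∀ᶠ i in l, toQuat (P i) ≠ toQuat (Q i) :=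
    fun hpr hP hQ => ((hP.sub hQ).eventually_ne
      (sub_ne_zero.2 ((smul_left_injective ℝ hx).ne hpr))).mono fun _ h => sub_ne_zero.1 h
  have hsepz : ∀ {P : ι → E3} {p : ℝ}, p ≠ 0 → Tendsto (fun i => toQuat (P i)) l (𝓝 (p • x)) →
      ∀ᶠ i in l, toQuat (P i) ≠ z i := fun hp hP =>
    ((hP.sub hzlim).eventually_ne (by simpa using ⟨hp, hx⟩)).mono fun _ h => sub_ne_zero.1 h
  have hqpos : ∀ᶠ i in l, 0 < (q i).re := by
    have h := (Quaternion.continuous_re.tendsto _).comp hqlim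
    refine h.eventually (lt_mem_nhds ?_)
    rw [Quaternion.re_coe]; norm_num
  have hev : ∀ᶠ i in l, insertPoint (A i) (B i) (C i) (D i) = OnePoint.some (z i) ∧
      ((toQuat (A i) - z i)⁻¹ + (toQuat (D i) - z i)⁻¹
          = (toQuat (B i) - z i)⁻¹ + (toQuat (C i) - z i)⁻¹) ∧ ∃ v, toQuat v = z i := by
    filter_upwards [hsep (by norm_num) hA hB, hsep (by norm_num) hA hC, hsep (by norm_num) hB hC,
      hsep (by norm_num) hC hD, hsepz (by norm_num) hA, hsepz (by norm_num) hB,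
      hsepz (by norm_num) hC, hsepz (by norm_num) hD, hw1lim.eventually_ne htwo,
      hqpos] with i hab hac hbc hcd haz hbz hcz hdz hw0 hqi
    have hqi' : 0 < (q i).re + ‖q i‖ := by positivity
    have hwi := congrFun hw i
    have hzi := congrFun hz i
    have hqd := congrFun hq i
    refine ⟨?_, ?_, ?_⟩
    · simp only [insertPoint, insertQuat]
      rw [← hqd, ← hwi, if_neg hw0, hzi]
    · refine inv_sub_add_inv_sub (s := qsqrt (q i)) hab hac hbc hcd haz hbz hcz hdz ?_ ?_
      · rw [qsqrt_mul_qsqrt hqi', hqd]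
      · have h1 : w i * (z i - toQuat (C i)) = toQuat (B i) - z i := by
          have : (w i + 1) * z i = w i * toQuat (C i) + toQuat (B i) := by
            rw [hzi, mul_inv_cancel_left₀ hw0]
          rw [add_mul, one_mul] at this
          rw [mul_sub, sub_eq_sub_iff_add_eq_add, this]
          abel
        have hzc : z i - toQuat (C i) ≠ 0 := sub_ne_zero.2 hcz.symm
        rw [← h1, mul_inv_cancel_right₀ hzc, hwi]
        have hba : toQuat (B i) - toQuat (A i) ≠ 0 := sub_ne_zero.2 hab.symm
        have hca : toQuat (C i) - toQuat (A i) ≠ 0 := sub_ne_zero.2 hac.symm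
        simp only [mul_assoc]
        rw [inv_mul_cancel_left₀ hba, mul_inv_cancel_left₀ hca]
    · refine exists_toQuat_eq (re_insert_eq_zero (s := qsqrt (q i)) hab hac hbc hcd rfl rfl rfl rfl
        ?_ ?_ ?_ ?_)
      · rwa [← hqd]
      · rw [← hqd]
      · rw [← hwi, hzi]
      · rwa [← hwi]
  obtain ⟨ζ, hζ⟩ := (hev.mono fun i hi => hi.2.2).choice
  refine ⟨ζ, hzlim.congr' (hζ.mono fun i hi => hi.symm), ?_⟩
  filter_upwards [hev, hζ] with i hi hζi
  rw [hζi]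
  exact ⟨hi.1, hi.2.1⟩

theorem eventually_crossRatioNotNeg {ι : Type*} {l : Filter ι} {P Q R T : ι → E3} {x : ℍ[ℝ]}
    {p q r t : ℝ} (hx : x ≠ 0) (hqr : q ≠ r) (htp : t ≠ p)
    (hpos : 0 < (p - q) * (q - r)⁻¹ * (r - t) * (t - p)⁻¹)
    (hP : Tendsto (fun i => toQuat (P i)) l (𝓝 (p • x)))
    (hQ : Tendsto (fun i => toQuat (Q i)) l (𝓝 (q • x)))
    (hR : Tendsto (fun i => toQuat (R i)) l (𝓝 (r • x)))
    (hT : Tendsto (fun i => toQuat (T i)) l (𝓝 (t • x))) :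
    ∀ᶠ i in l, CrossRatioNotNeg (P i) (Q i) (R i) (T i) := by
  have h := (Quaternion.continuous_re.tendsto _).comp (tendsto_crossRatio hx hqr htp hP hQ hR hT)
  rw [Quaternion.re_coe] at h
  filter_upwards [h.eventually (lt_mem_nhds hpos)] with i hi
  rintro ⟨τ, hτ, e⟩
  simp only [Function.comp] at hi
  rw [e, Quaternion.re_coe] at hi
  linarith

theorem crossRatioNotNeg_add_smul (v : E3) {a b c d : E3} {ε : ℝ} (hε : ε ≠ 0)
    (h : CrossRatioNotNeg a b c d) :
    CrossRatioNotNeg (v + ε • a) (v + ε • b) (v + ε • c) (v + ε • d) := by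
  unfold CrossRatioNotNeg at h ⊢
  simp only [toQuat_add, toQuat_smul]
  rwa [crossRatio_add_smul _ _ _ _ _ hε]

/-! ### The curvature vector -/

theorem inner_eq (v w : E3) : inner ℝ v w = v 0 * w 0 + v 1 * w 1 + v 2 * w 2 := by
  simp [PiLp.inner_apply, Fin.sum_univ_three, mul_comm]

theorem norm_sq_eq (v : E3) : ‖v‖ ^ 2 = v 0 ^ 2 + v 1 ^ 2 + v 2 ^ 2 := by
  rw [← real_inner_self_eq_norm_sq, inner_eq]; ring

theorem cross_zero_apply (v w : E3) : cross v w 0 = v 1 * w 2 - v 2 * w 1 := by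
  simp [cross, cross_apply]

theorem cross_one_apply (v w : E3) : cross v w 1 = v 2 * w 0 - v 0 * w 2 := by
  simp [cross, cross_apply]

theorem cross_two_apply (v w : E3) : cross v w 2 = v 0 * w 1 - v 1 * w 0 := by
  simp [cross, cross_apply]

theorem cross_smul_smul (r t : ℝ) (v w : E3) : cross (r • v) (t • w) = (r * t) • cross v w := by
  ext i
  fin_cases i <;> simp [cross_zero_apply, cross_one_apply, cross_two_apply] <;> ring

theorem cross_cross_self {v : E3} (hv : v ≠ 0) (w : E3) :
    cross (cross v w) v = (‖v‖ ^ 2) • foot w v := by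
  have h : inner ℝ v v ≠ (0 : ℝ) := inner_self_ne_zero.2 hv
  rw [foot, smul_sub, smul_smul, ← real_inner_self_eq_norm_sq, mul_div_cancel₀ _ h, inner_eq,
    inner_eq]
  ext i
  fin_cases i <;> simp [cross_zero_apply, cross_one_apply, cross_two_apply] <;> ring

theorem norm_cross_cross_self (v w : E3) : ‖cross (cross v w) v‖ = ‖cross v w‖ * ‖v‖ := by
  rw [← sq_eq_sq₀ (norm_nonneg _) (by positivity), mul_pow, norm_sq_eq, norm_sq_eq, norm_sq_eq]
  simp only [cross_zero_apply, cross_one_apply, cross_two_apply]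
  ring

theorem norm_foot_mul {v : E3} (hv : v ≠ 0) (w : E3) :
    ‖foot w v‖ / ‖v‖ ^ 2 = ‖cross v w‖ / ‖v‖ ^ 3 := by
  have h := norm_cross_cross_self v w
  have hp := norm_pos_iff.2 hv
  rw [cross_cross_self hv, norm_smul, norm_pow, norm_norm] at h
  field_simp
  nlinarith

/-- The curvature vector `κ N` is the component of `s''` orthogonal to `s'`, divided by `‖s'‖²`. -/
theorem curvature_smul_unitNormal {s : ℝ → E3} {u : ℝ} (h : deriv s u ≠ 0)
    (hκ : curvature s u ≠ 0) :
    curvature s u • unitNormal s u =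
      (‖deriv s u‖ ^ 2)⁻¹ • foot (iteratedDeriv 2 s u) (deriv s u) := by
  have hp := norm_pos_iff.2 h
  have hc : ‖cross (deriv s u) (iteratedDeriv 2 s u)‖ ≠ 0 := by
    intro h0; exact hκ (by rw [curvature, h0, zero_div])
  rw [unitNormal, cross_smul_smul, cross_cross_self h, smul_smul, smul_smul, curvature]
  congr 1
  field_simp

theorem foot_sub (v w d : E3) : foot (v - w) d = foot v d - foot w d := by
  rw [foot, foot, foot, inner_sub_left, sub_div, sub_smul]; abel

theorem foot_smul_left (r : ℝ) (w d : E3) : foot (r • w) d = r • foot w d := by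
  rw [foot, foot, real_inner_smul_left, smul_sub, smul_smul, mul_div_assoc]

theorem foot_self (d : E3) : foot d d = 0 := by
  rcases eq_or_ne d 0 with rfl | h
  · simp [foot]
  · have : inner ℝ d d ≠ (0 : ℝ) := inner_self_ne_zero.2 h
    rw [foot, div_self this, one_smul, sub_self]

/-- The derivative at `x` of the inversion in the unit sphere, in terms of quaternions. -/
theorem toQuat_inversion_derivative {x : E3} (hx : x ≠ 0) (w : E3) :
    toQuat ((‖x‖ ^ 2)⁻¹ • w - (2 * inner ℝ x w / ‖x‖ ^ 4) • x)
      = (toQuat x)⁻¹ * toQuat w * (toQuat x)⁻¹ := by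
  have hp := norm_pos_iff.2 hx
  have e : toQuat x * toQuat w * toQuat x = toQuat ((‖x‖ ^ 2) • w - (2 * inner ℝ x w) • x) := by
    rw [norm_sq_eq, inner_eq, toQuat_sub, toQuat_smul, toQuat_smul]
    ext <;> simp only [Quaternion.re_mul, Quaternion.imI_mul, Quaternion.imJ_mul,
      Quaternion.imK_mul, Quaternion.re_sub, Quaternion.imI_sub, Quaternion.imJ_sub,
      Quaternion.imK_sub, Quaternion.re_smul, Quaternion.imI_smul, Quaternion.imJ_smul,
      Quaternion.imK_smul, toQuat_re, toQuat_imI, toQuat_imJ, toQuat_imK, smul_eq_mul] <;> ring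
  rw [inv_toQuat, invert, toQuat_smul, neg_mul, neg_mul_neg, smul_mul_assoc, smul_mul_smul_comm, e,
    ← toQuat_smul, smul_sub, smul_smul, smul_smul]
  congr 3
  · field_simp
  · field_simp

/-! ### The inverted vertices and the limit of the discrete curvature circle -/

theorem isBigO_comp_sub {ι E F : Type*} [NormedAddCommGroup E] [NormedSpace ℝ E]
    [NormedAddCommGroup F] [NormedSpace ℝ F] {l : Filter ι} {Φ : E → F} {f : ι → E} {e : E}
    {g : ι → ℝ} (hΦ : DifferentiableAt ℝ Φ e) (hg : Tendsto g l (𝓝 0))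
    (hf : (fun i => f i - e) =O[l] g) : (fun i => Φ (f i) - Φ e) =O[l] g := by
  have hlim : Tendsto f l (𝓝 e) := tendsto_sub_nhds_zero_iff.1 (hf.trans_tendsto hg)
  exact (hΦ.isBigO_sub.comp_tendsto hlim).trans hf

theorem differentiableAt_invert {v : E3} (hv : v ≠ 0) : DifferentiableAt ℝ invert v := by
  have : DifferentiableAt ℝ (fun v : E3 => (‖v‖ ^ 2)⁻¹ • v) v := by
    have h : DifferentiableAt ℝ (fun v : E3 => ‖v‖ ^ 2) v := differentiableAt_id.norm_sq ℝ
    have hp := norm_pos_iff.2 hv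
    exact (h.inv (by positivity)).smul differentiableAt_id
  exact this

theorem differentiableAt_foot {w d : E3} (hd : d ≠ 0) :
    DifferentiableAt ℝ (fun p : E3 × E3 => foot p.1 p.2) (w, d) := by
  have hdd : (inner ℝ d d : ℝ) ≠ 0 := inner_self_ne_zero.2 hd
  have h1 : DifferentiableAt ℝ (fun p : E3 × E3 => p.1) (w, d) := differentiableAt_fst
  have h2 : DifferentiableAt ℝ (fun p : E3 × E3 => p.2) (w, d) := differentiableAt_snd
  have h3 : DifferentiableAt ℝ (fun p : E3 × E3 => (inner ℝ p.1 p.2 : ℝ)) (w, d) := h1.inner ℝ h2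
  have h4 : DifferentiableAt ℝ (fun p : E3 × E3 => (inner ℝ p.2 p.2 : ℝ)) (w, d) := h2.inner ℝ h2
  have h5 : DifferentiableAt ℝ (fun p : E3 × E3 => (inner ℝ p.1 p.2 * (inner ℝ p.2 p.2)⁻¹ : ℝ))
      (w, d) := h3.fun_mul (h4.fun_inv hdd)
  simp only [← div_eq_mul_inv] at h5
  unfold foot
  exact h1.fun_sub (h5.fun_smul h2)

theorem differentiableAt_bisector {α β : E3} (hα : α ≠ 0) (hβ : β ≠ 0) :
    DifferentiableAt ℝ (fun p : E3 × E3 => bisector p.1 p.2) (α, β) := by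
  have h1 : DifferentiableAt ℝ (fun p : E3 × E3 => p.1) (α, β) := differentiableAt_fst
  have h2 : DifferentiableAt ℝ (fun p : E3 × E3 => p.2) (α, β) := differentiableAt_snd
  have h3 : DifferentiableAt ℝ (fun p : E3 × E3 => ‖p.1‖) (α, β) := h1.norm ℝ hα
  have h4 : DifferentiableAt ℝ (fun p : E3 × E3 => ‖p.2‖) (α, β) := h2.norm ℝ hβ
  unfold bisector
  exact (h3.fun_smul h2).fun_add (h4.fun_smul h1)

theorem invert_smul (r : ℝ) (v : E3) : invert (r • v) = r⁻¹ • invert v := by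
  rcases eq_or_ne r 0 with rfl | hr
  · simp [invert]
  · rw [invert, invert, norm_smul, mul_pow, Real.norm_eq_abs, sq_abs, mul_inv, smul_smul, smul_smul]
    congr 1
    field_simp

theorem bisector_smul (r : ℝ) (α β : E3) :
    bisector (r • α) (r • β) = (|r| * r) • bisector α β := by
  simp only [bisector, norm_smul, Real.norm_eq_abs]
  module

theorem tendsto_pow_nhdsNE {n : ℕ} (hn : n ≠ 0) :
    Tendsto (fun ε : ℝ => ε ^ n) (𝓝[≠] 0) (𝓝 0) := by
  have : Continuous (fun ε : ℝ => ε ^ n) := by fun_prop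
  simpa [hn] using (this.tendsto 0).mono_left nhdsWithin_le_nhds

/-- In the rescaled coordinates `(· - s u) / ε`, the inverses of the vertices in the unit sphere
around the inserted point `ζ` form the parallelogram `ε W ± α`, `ε W ± β`. The limit of `W` is the
derivative of the inversion at `s'`, applied to `s'' / 2`. -/
theorem exists_parallelogram {s : ℝ → E3} (hs : ContDiff ℝ 4 s) {u : ℝ} (hreg : deriv s u ≠ 0) :
    ∃ ζ W α β : ℝ → E3,
      (∀ᶠ ε in 𝓝[≠] 0, insertPoint (chord s u (-3) ε) (chord s u (-1) ε) (chord s u 1 ε)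
        (chord s u 3 ε) = OnePoint.some (toQuat (ζ ε))) ∧
      (∀ᶠ ε in 𝓝[≠] 0, invert (chord s u (-3) ε - ζ ε) = ε • W ε + α ε ∧
        invert (chord s u (-1) ε - ζ ε) = ε • W ε + β ε ∧
        invert (chord s u 1 ε - ζ ε) = ε • W ε - β ε ∧
        invert (chord s u 3 ε - ζ ε) = ε • W ε - α ε) ∧
      ζ =O[𝓝[≠] 0] (fun ε : ℝ => ε ^ 3) ∧
      (fun ε => W ε - ((‖deriv s u‖ ^ 2)⁻¹ • ((1 / 2 : ℝ) • iteratedDeriv 2 s u) -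
        (2 * inner ℝ (deriv s u) ((1 / 2 : ℝ) • iteratedDeriv 2 s u) / ‖deriv s u‖ ^ 4) •
          deriv s u)) =O[𝓝[≠] 0] (fun ε : ℝ => ε ^ 2) ∧
      (fun ε => α ε - (-(1 / 3) : ℝ) • invert (deriv s u)) =O[𝓝[≠] 0] (fun ε : ℝ => ε ^ 2) ∧
      (fun ε => β ε - (-1 : ℝ) • invert (deriv s u)) =O[𝓝[≠] 0] (fun ε : ℝ => ε ^ 2) := by
  obtain ⟨x₃, hT⟩ := exists_taylor hs u
  obtain ⟨g, hg⟩ := exists_inv_chord_expansion hreg hT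
  have hG1 := toQuat_inversion_derivative hreg ((1 / 2 : ℝ) • iteratedDeriv 2 s u)
  rw [← hG1] at hg
  generalize (‖deriv s u‖ ^ 2)⁻¹ • ((1 / 2 : ℝ) • iteratedDeriv 2 s u) -
    (2 * inner ℝ (deriv s u) ((1 / 2 : ℝ) • iteratedDeriv 2 s u) / ‖deriv s u‖ ^ 4) •
      deriv s u = G at *
  have hlim : ∀ j : ℝ, Tendsto (fun ε => toQuat (chord s u j ε)) (𝓝[≠] 0)
      (𝓝 (j • toQuat (deriv s u))) := fun j => tendsto_of_expansion (chord_expansion hT j)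
  have hx : toQuat (deriv s u) ≠ 0 := toQuat_eq_zero.not.2 hreg
  obtain ⟨ζ, hζ, hev⟩ := exists_insertPoint_tendsto hx (hlim _) (hlim _) (hlim _) (hlim _)
  have hζ3 : (fun ε => toQuat (ζ ε)) =O[𝓝[≠] 0] (fun ε : ℝ => ε ^ 3) := by
    refine isBigO_of_residual hx (hlim _) (hlim _) (hlim _) (hlim _) hζ (hev.mono fun _ h => h.2) ?_
    -- all terms of the expansion up to the second order cancel
    refine (((hg (-3) (by norm_num)).add (hg 3 (by norm_num))).sub
      ((hg (-1) (by norm_num)).add (hg 1 (by norm_num)))).congr_left fun ε => ?_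
    norm_num
    module
  have hZ : ∀ j : ℝ, j ≠ 0 → (fun ε => toQuat (invert (chord s u j ε - ζ ε)) -
      (j⁻¹ • toQuat (invert (deriv s u)) + ε • toQuat G - ε ^ 2 • j • g)) =O[𝓝[≠] 0]
        (fun ε : ℝ => ε ^ 3) := by
    intro j hj
    have h := (inv_sub_isBigO (smul_ne_zero hj hx) (hlim j) hζ hζ3).add (hg j hj)
    refine h.neg_left.congr_left fun ε => ?_
    rw [← toQuat_sub, inv_toQuat (chord s u j ε - ζ ε), inv_toQuat (deriv s u)]
    module
  obtain ⟨Z, hZdef⟩ : ∃ Z : ℝ → ℝ → E3, Z = fun j ε => invert (chord s u j ε - ζ ε) := ⟨_, rfl⟩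
  have hZd : ∀ j ε, invert (chord s u j ε - ζ ε) = Z j ε := fun j ε => by rw [hZdef]
  simp only [hZd] at hZ
  have h2 := isBigO_pow_of_le (show 2 ≤ 3 by norm_num)
  have hg2 : ∀ r : ℝ, (fun ε : ℝ => ε ^ 2 • (r • g)) =O[𝓝[≠] 0] (fun ε : ℝ => ε ^ 2) := fun r => by
    have := (isBigO_refl (fun ε : ℝ => ε ^ 2) (𝓝[≠] 0)).smul
      (isBigO_const_const (r • g) (one_ne_zero (α := ℝ)) (𝓝[≠] 0))
    simpa using this
  refine ⟨ζ, fun ε => (2 * ε)⁻¹ • (Z (-3) ε + Z 3 ε), fun ε => (1 / 2 : ℝ) • (Z (-3) ε - Z 3 ε),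
    fun ε => (1 / 2 : ℝ) • (Z (-1) ε - Z 1 ε), hev.mono fun _ h => h.1, ?_,
    isBigO_toQuat_iff.1 hζ3, ?_, ?_, ?_⟩
  · filter_upwards [hev, self_mem_nhdsWithin] with ε hε hε0
    have hε' : ε ≠ 0 := hε0
    have hsum : Z (-3) ε + Z 3 ε = Z (-1) ε + Z 1 ε := by
      apply toQuat_injective
      have h := hε.2
      simp only [← toQuat_sub, inv_toQuat, hZd] at h
      rw [toQuat_add, toQuat_add, ← neg_inj, neg_add, neg_add]
      exact h
    have hW : ε • (2 * ε)⁻¹ • (Z (-3) ε + Z 3 ε) = (1 / 2 : ℝ) • (Z (-3) ε + Z 3 ε) := by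
      rw [smul_smul]; congr 1; field_simp
    simp only [hZd, hW]
    refine ⟨by module, ?_, ?_, by module⟩
    · rw [hsum]; module
    · rw [hsum]; module
  · rw [← isBigO_toQuat_iff]
    have h := ((isBigO_refl (fun ε : ℝ => (2 * ε)⁻¹) (𝓝[≠] 0)).smul
      ((hZ (-3) (by norm_num)).add (hZ 3 (by norm_num))))
    have h' : (fun ε : ℝ => (2 * ε)⁻¹ • ε ^ 3) =O[𝓝[≠] 0] (fun ε : ℝ => ε ^ 2) := by
      refine ((isBigO_refl (fun ε : ℝ => ε ^ 2) (𝓝[≠] 0)).const_mul_left (1 / 2)).congr' ?_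
        EventuallyEq.rfl
      filter_upwards [self_mem_nhdsWithin] with ε hε
      have hε' : ε ≠ 0 := hε
      rw [smul_eq_mul]
      field_simp
    refine (h.trans h').congr' ?_ EventuallyEq.rfl
    filter_upwards [self_mem_nhdsWithin] with ε hε
    have hε' : ε ≠ 0 := hε
    have e : toQuat G = (2 * ε)⁻¹ • ((2 * ε) • toQuat G) := by
      rw [smul_smul, inv_mul_cancel₀ (by positivity), one_smul]
    rw [toQuat_sub, toQuat_smul, toQuat_add]
    nth_rewrite 3 [e]
    rw [← smul_sub]
    congr 1
    norm_num
    module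
  · rw [← isBigO_toQuat_iff]
    refine ((((hZ (-3) (by norm_num)).sub (hZ 3 (by norm_num))).trans h2).const_smul_left
      (1 / 2 : ℝ) |>.add (hg2 3)).congr_left fun ε => ?_
    rw [toQuat_sub, toQuat_smul, toQuat_smul, toQuat_sub]
    simp only [Pi.smul_apply]
    norm_num
    module
  · rw [← isBigO_toQuat_iff]
    refine ((((hZ (-1) (by norm_num)).sub (hZ 1 (by norm_num))).trans h2).const_smul_left
      (1 / 2 : ℝ) |>.add (hg2 1)).congr_left fun ε => ?_
    rw [toQuat_sub, toQuat_smul, toQuat_smul, toQuat_sub]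
    simp only [Pi.smul_apply]
    norm_num
    module

/-! ### Nonsingularity, and the discrete curvature circle of the sampled curve -/

theorem sample_eq (s : ℝ → E3) (u : ℝ) {ε : ℝ} (hε : ε ≠ 0) (k : ℤ) :
    sample s u ε k = s u + ε • chord s u (2 * k - 1) ε := by
  rw [add_smul_chord s u _ hε, sample]

theorem sample_neg_one (s : ℝ → E3) (u : ℝ) {ε : ℝ} (hε : ε ≠ 0) :
    sample s u ε (-1) = s u + ε • chord s u (-3) ε := by
  rw [sample_eq s u hε]; norm_num

theorem sample_zero (s : ℝ → E3) (u : ℝ) {ε : ℝ} (hε : ε ≠ 0) :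
    sample s u ε 0 = s u + ε • chord s u (-1) ε := by
  rw [sample_eq s u hε]; norm_num

theorem sample_one (s : ℝ → E3) (u : ℝ) {ε : ℝ} (hε : ε ≠ 0) :
    sample s u ε 1 = s u + ε • chord s u 1 ε := by
  rw [sample_eq s u hε]; norm_num

theorem sample_two (s : ℝ → E3) (u : ℝ) {ε : ℝ} (hε : ε ≠ 0) :
    sample s u ε 2 = s u + ε • chord s u 3 ε := by
  rw [sample_eq s u hε]; norm_num

theorem eventually_nonsingular {s : ℝ → E3} (hs : ContDiff ℝ 4 s) {u : ℝ} (hreg : deriv s u ≠ 0) :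
    ∀ᶠ ε in 𝓝[≠] (0 : ℝ), Nonsingular (sample s u ε) 0 := by
  obtain ⟨x₃, hT⟩ := exists_taylor hs u
  have hlim : ∀ j : ℝ, Tendsto (fun ε => toQuat (chord s u j ε)) (𝓝[≠] 0)
      (𝓝 (j • toQuat (deriv s u))) := fun j => tendsto_of_expansion (chord_expansion hT j)
  have hx : toQuat (deriv s u) ≠ 0 := toQuat_eq_zero.not.2 hreg
  have hne : ∀ i j : ℝ, i ≠ j → ∀ᶠ ε in 𝓝[≠] (0 : ℝ),
      s u + ε • chord s u i ε ≠ s u + ε • chord s u j ε := by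
    intro i j hij
    have h := ((hlim i).sub (hlim j)).eventually_ne
      (sub_ne_zero.2 ((smul_left_injective ℝ hx).ne hij))
    filter_upwards [h, self_mem_nhdsWithin] with ε h1 hε h2
    rw [add_right_inj, smul_right_inj hε] at h2
    rw [h2, sub_self] at h1
    exact h1 rfl
  have hcr : ∀ i j k m : ℝ, j ≠ k → m ≠ i → 0 < (i - j) * (j - k)⁻¹ * (k - m) * (m - i)⁻¹ →
      ∀ᶠ ε in 𝓝[≠] (0 : ℝ), CrossRatioNotNeg (s u + ε • chord s u i ε) (s u + ε • chord s u j ε)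
        (s u + ε • chord s u k ε) (s u + ε • chord s u m ε) := by
    intro i j k m hjk hmi hpos
    filter_upwards [eventually_crossRatioNotNeg hx hjk hmi hpos (hlim i) (hlim j) (hlim k) (hlim m),
      self_mem_nhdsWithin] with ε h hε
    exact crossRatioNotNeg_add_smul _ hε h
  filter_upwards [hne (-3) (-1) (by norm_num), hne (-3) 1 (by norm_num), hne (-3) 3 (by norm_num),
    hne (-1) 1 (by norm_num), hne (-1) 3 (by norm_num), hne 1 3 (by norm_num),
    hcr 1 (-3) (-1) 3 (by norm_num) (by norm_num) (by norm_num),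
    hcr 3 (-1) 1 (-3) (by norm_num) (by norm_num) (by norm_num),
    hcr (-3) 1 3 (-1) (by norm_num) (by norm_num) (by norm_num),
    hcr (-1) 3 (-3) 1 (by norm_num) (by norm_num) (by norm_num),
    self_mem_nhdsWithin] with ε h1 h2 h3 h4 h5 h6 c1 c2 c3 c4 hε
  have hε' : ε ≠ 0 := hε
  have hiff : Nonsingular (sample s u ε) 0 ↔
      ([sample s u ε (-1), sample s u ε 0, sample s u ε 1, sample s u ε 2].Nodup ∧
      CrossRatioNotNeg (sample s u ε 1) (sample s u ε (-1)) (sample s u ε 0) (sample s u ε 2) ∧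
      CrossRatioNotNeg (sample s u ε 2) (sample s u ε 0) (sample s u ε 1) (sample s u ε (-1)) ∧
      CrossRatioNotNeg (sample s u ε (-1)) (sample s u ε 1) (sample s u ε 2) (sample s u ε 0) ∧
      CrossRatioNotNeg (sample s u ε 0) (sample s u ε 2) (sample s u ε (-1)) (sample s u ε 1)) :=
    Iff.rfl
  rw [hiff, sample_neg_one s u hε', sample_zero s u hε', sample_one s u hε', sample_two s u hε']
  exact ⟨by simp only [List.nodup_cons, List.mem_cons, List.not_mem_nil, not_or, or_false]; tauto,
    c1, c2, c3, c4⟩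

/-- The discrete curvature circle of the sampled curve is the inverse, in the unit sphere around
the inserted point `s u + ε ζ`, of a line whose point nearest to the origin is `F`, where `2 F` is
the curvature vector of `s` up to an error of order `ε²`. -/
theorem exists_discreteCurvatureCircle {s : ℝ → E3} (hs : ContDiff ℝ 4 s) {u : ℝ}
    (hreg : deriv s u ≠ 0) :
    ∃ ζ F δ : ℝ → E3,
      (∀ᶠ ε in 𝓝[≠] 0,
        insertPoint (sample s u ε (-1)) (sample s u ε 0) (sample s u ε 1) (sample s u ε 2)
            = OnePoint.some (toQuat (s u + ε • ζ ε)) ∧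
        ∃ (hδ : δ ε ≠ 0) (h : inner ℝ (F ε) (δ ε) = 0), ∀ k,
          IsDiscreteCurvatureCircle (sample s u ε) 0 k ↔
            ∃ hF : F ε ≠ 0, k = circleOfLine (s u + ε • ζ ε) hF hδ h) ∧
      ζ =O[𝓝[≠] 0] (fun ε : ℝ => ε ^ 3) ∧
      (fun ε => F ε - (1 / 2 : ℝ) • (‖deriv s u‖ ^ 2)⁻¹ • foot (iteratedDeriv 2 s u) (deriv s u))
        =O[𝓝[≠] 0] (fun ε : ℝ => ε ^ 2) := by
  obtain ⟨ζ, W, α, β, hins, hpar, hζ, hW, hα, hβ⟩ := exists_parallelogram hs hreg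
  have hx : 0 < ‖deriv s u‖ := norm_pos_iff.2 hreg
  have hG0 : invert (deriv s u) ≠ 0 := by
    rw [← norm_ne_zero_iff, norm_invert]; positivity
  have hGn := norm_pos_iff.2 hG0
  have h2 := tendsto_pow_nhdsNE (n := 2) (by norm_num)
  have hWlim := tendsto_sub_nhds_zero_iff.1 (hW.trans_tendsto h2)
  have hαlim := tendsto_sub_nhds_zero_iff.1 (hα.trans_tendsto h2)
  have hβlim := tendsto_sub_nhds_zero_iff.1 (hβ.trans_tendsto h2)
  have hbis : bisector ((-(1 / 3) : ℝ) • invert (deriv s u)) ((-1 : ℝ) • invert (deriv s u))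
      = (-(2 / 3) * ‖invert (deriv s u)‖ * (‖deriv s u‖ ^ 2)⁻¹) • deriv s u := by
    simp only [bisector, norm_smul]
    norm_num
    simp only [invert]
    module
  have hbis0 : -(2 / 3) * ‖invert (deriv s u)‖ * (‖deriv s u‖ ^ 2)⁻¹ ≠ 0 :=
    mul_ne_zero (mul_ne_zero (by norm_num) hGn.ne') (by positivity)
  refine ⟨ζ, fun ε => foot (W ε) (bisector (α ε) (β ε)),
    fun ε => bisector (ε⁻¹ • α ε) (ε⁻¹ • β ε), ?_, hζ, ?_⟩
  · have hlt1 : ∀ᶠ ε in 𝓝[≠] (0 : ℝ), ‖ε • W ε‖ < ‖α ε‖ := by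
      have h := (tendsto_pow_nhdsNE (n := 1) (by norm_num)).smul hWlim
      simp only [pow_one, zero_smul] at h
      refine h.norm.eventually_lt hαlim.norm ?_
      rw [norm_zero, norm_smul]
      exact mul_pos (by norm_num) hGn
    have hlt2 : ∀ᶠ ε in 𝓝[≠] (0 : ℝ), ‖α ε‖ < ‖β ε‖ := by
      refine hαlim.norm.eventually_lt hβlim.norm ?_
      rw [norm_smul, norm_smul]
      norm_num
      linarith
    have hin : ∀ᶠ ε in 𝓝[≠] (0 : ℝ), 0 < inner ℝ (α ε) (β ε) := by
      refine (hαlim.inner hβlim).eventually (lt_mem_nhds ?_)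
      rw [real_inner_smul_left, real_inner_smul_right, real_inner_self_eq_norm_sq]
      norm_num
      positivity
    filter_upwards [hins, hpar, hlt1, hlt2, hin, self_mem_nhdsWithin] with ε hins hpar hlt1 hlt2
      hin hε
    have hε' : ε ≠ 0 := hε
    have hεp : 0 < ‖ε‖ := norm_pos_iff.2 hε'
    have hY : insertPoint (sample s u ε (-1)) (sample s u ε 0) (sample s u ε 1) (sample s u ε 2)
        = OnePoint.some (toQuat (s u + ε • ζ ε)) := by
      rw [sample_neg_one s u hε', sample_zero s u hε', sample_one s u hε', sample_two s u hε']
      simp only [insertPoint, toQuat_add, toQuat_smul]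
      exact insertQuat_add_smul _ hε' hins
    have hin' : 0 < inner ℝ (ε⁻¹ • α ε) (ε⁻¹ • β ε) := by
      rw [real_inner_smul_left, real_inner_smul_right, ← mul_assoc]
      have : 0 < ε⁻¹ * ε⁻¹ := mul_self_pos.2 (inv_ne_zero hε')
      positivity
    -- `ε⁻¹` is the scale of the parallelogram in the original coordinates; it does not affect `F`
    have hbis : foot (W ε) (bisector (ε⁻¹ • α ε) (ε⁻¹ • β ε))
        = foot (W ε) (bisector (α ε) (β ε)) := by
      rw [bisector_smul, foot_smul]
      exact mul_ne_zero (abs_ne_zero.2 (inv_ne_zero hε')) (inv_ne_zero hε')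
    have hvert : ∀ (j : ℝ) (v : E3), invert (chord s u j ε - ζ ε) = ε • W ε + v →
        s u + ε • chord s u j ε = s u + ε • ζ ε + invert (W ε + ε⁻¹ • v) := by
      intro j v hv
      have h1 : W ε + ε⁻¹ • v = ε⁻¹ • (ε • W ε + v) := by
        rw [smul_add, smul_smul, inv_mul_cancel₀ hε', one_smul]
      rw [h1, ← hv, invert_smul, inv_inv, invert_invert, smul_sub]
      abel
    obtain ⟨p1, p2, p3, p4⟩ := hpar
    refine ⟨hY, bisector_ne_zero hin', ?_, ?_⟩
    · rw [← hbis]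
      exact inner_foot _ (bisector_ne_zero hin')
    · intro k
      have := isDiscreteCurvatureCircle_iff (Γ := sample s u ε) (W := W ε)
        (by rw [sample_neg_one s u hε', hvert _ _ p1]) (by rw [sample_zero s u hε', hvert _ _ p2])
        (by rw [sample_one s u hε', hvert 1 (-β ε) (by rw [p3, sub_eq_add_neg]), smul_neg,
          ← sub_eq_add_neg])
        (by rw [sample_two s u hε', hvert 3 (-α ε) (by rw [p4, sub_eq_add_neg]), smul_neg,
          ← sub_eq_add_neg]) hY
        (by
          rw [norm_smul] at hlt1 ⊢
          rw [norm_inv, ← div_eq_inv_mul, lt_div_iff₀ hεp, mul_comm]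
          exact hlt1)
        (by
          rw [norm_smul, norm_smul]
          exact mul_lt_mul_of_pos_left hlt2 (norm_pos_iff.2 (inv_ne_zero hε')))
        hin' (bisector_ne_zero hin') k
      simp only [hbis] at this
      exact this
  · have hα0 : (-(1 / 3) : ℝ) • invert (deriv s u) ≠ 0 := smul_ne_zero (by norm_num) hG0
    have hβ0 : (-1 : ℝ) • invert (deriv s u) ≠ 0 := smul_ne_zero (by norm_num) hG0
    have hδ := isBigO_comp_sub (f := fun ε => (α ε, β ε)) (differentiableAt_bisector hα0 hβ0) h2
      (hα.prod_left hβ)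
    rw [hbis] at hδ
    have hF := isBigO_comp_sub (f := fun ε => (W ε, bisector (α ε) (β ε)))
      (differentiableAt_foot (smul_ne_zero hbis0 hreg)) h2
      (hW.prod_left hδ)
    refine hF.congr_left fun ε => ?_
    simp only
    rw [foot_smul _ _ hbis0, foot_sub, foot_smul_left, foot_smul_left, foot_smul_left, foot_self,
      smul_zero, sub_zero, smul_comm]

end SpaceCurve

end

theorem mainTheorem2 (s : ℝ → SpaceCurve.E3) (hs : ContDiff ℝ 4 s) (u : ℝ)
    (hreg : deriv s u ≠ 0) :
    -- for small `ε` the insertion rule is well defined on the sampled curve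
    (∀ᶠ ε in 𝓝[≠] (0 : ℝ), SpaceCurve.Nonsingular (SpaceCurve.sample s u ε) 0) ∧
    -- the discrete curvature
    ((fun ε : ℝ => SpaceCurve.discreteCurvature (SpaceCurve.sample s u ε) 0
        - SpaceCurve.curvature s u) =O[𝓝[≠] (0 : ℝ)] (fun ε : ℝ => ε ^ 2)) ∧
    -- the inserted point, which is a point of three-space
    (∃ p : ℝ → SpaceCurve.E3,
      (∀ᶠ ε in 𝓝[≠] (0 : ℝ),
        SpaceCurve.insertPoint (SpaceCurve.sample s u ε (-1)) (SpaceCurve.sample s u ε 0)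
          (SpaceCurve.sample s u ε 1) (SpaceCurve.sample s u ε 2)
          = OnePoint.some (SpaceCurve.toQuat (p ε))) ∧
      (fun ε : ℝ => p ε - s u) =O[𝓝[≠] (0 : ℝ)] (fun ε : ℝ => ε ^ 3)) ∧
    -- the discrete curvature circle and its center
    (SpaceCurve.curvature s u ≠ 0 →
      (∀ᶠ ε in 𝓝[≠] (0 : ℝ),
        ∃! k, SpaceCurve.IsDiscreteCurvatureCircle (SpaceCurve.sample s u ε) 0 k) ∧
      (fun ε : ℝ => SpaceCurve.discreteCenter (SpaceCurve.sample s u ε) 0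
        - (s u + (1 / SpaceCurve.curvature s u) • SpaceCurve.unitNormal s u))
        =O[𝓝[≠] (0 : ℝ)] (fun ε : ℝ => ε ^ 2)) := by
  have hx : 0 < ‖deriv s u‖ := norm_pos_iff.2 hreg
  have hκ : ‖(‖deriv s u‖ ^ 2)⁻¹ • SpaceCurve.foot (iteratedDeriv 2 s u) (deriv s u)‖
      = SpaceCurve.curvature s u := by
    rw [norm_smul, norm_inv, norm_pow, norm_norm, inv_mul_eq_div, SpaceCurve.norm_foot_mul hreg,
      SpaceCurve.curvature]
  obtain ⟨ζ, F, δ, hcirc, hζ, hF⟩ := SpaceCurve.exists_discreteCurvatureCircle hs hreg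
  have hζ' : (fun ε : ℝ => ε • ζ ε) =O[𝓝[≠] 0] (fun ε : ℝ => ε ^ 4) := by
    refine ((isBigO_refl (fun ε : ℝ => ε) (𝓝[≠] 0)).smul hζ).congr_right fun ε => ?_
    rw [smul_eq_mul]
    ring
  refine ⟨SpaceCurve.eventually_nonsingular hs hreg, ?_, ⟨fun ε => s u + ε • ζ ε, ?_, ?_⟩, ?_⟩
  · have hle : (fun ε => 2 * ‖F ε‖ - SpaceCurve.curvature s u) =O[𝓝[≠] (0 : ℝ)]
        (fun ε : ℝ => ε ^ 2) := by
      refine IsBigO.trans (IsBigO.of_bound 2 (Eventually.of_forall fun ε => ?_)) hF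
      have h := abs_norm_sub_norm_le (F ε)
        ((1 / 2 : ℝ) • (‖deriv s u‖ ^ 2)⁻¹ • SpaceCurve.foot (iteratedDeriv 2 s u) (deriv s u))
      rw [norm_smul (1 / 2 : ℝ), hκ, Real.norm_of_nonneg (by norm_num : (0 : ℝ) ≤ 1 / 2)] at h
      rw [Real.norm_eq_abs, show 2 * ‖F ε‖ - SpaceCurve.curvature s u
        = 2 * (‖F ε‖ - 1 / 2 * SpaceCurve.curvature s u) by ring, abs_mul, abs_two]
      linarith
    refine hle.congr' ?_ EventuallyEq.rfl
    filter_upwards [hcirc] with ε hε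
    obtain ⟨-, hδ, h, hk⟩ := hε
    rw [SpaceCurve.discreteCurvature_eq hδ h hk]
  · exact hcirc.mono fun ε hε => hε.1
  · simp only [add_sub_cancel_left]
    exact hζ'.trans (SpaceCurve.isBigO_pow_of_le (by norm_num))
  · intro hκ0
    have hN := SpaceCurve.curvature_smul_unitNormal hreg hκ0
    have hinv : (1 / 2 : ℝ) • SpaceCurve.invert ((1 / 2 : ℝ) • (‖deriv s u‖ ^ 2)⁻¹ •
        SpaceCurve.foot (iteratedDeriv 2 s u) (deriv s u))
        = (1 / SpaceCurve.curvature s u) • SpaceCurve.unitNormal s u := by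
      rw [SpaceCurve.invert_smul, smul_smul, SpaceCurve.invert, hκ, ← hN, smul_smul, smul_smul]
      congr 1
      field_simp
    have hF0 : (1 / 2 : ℝ) • (‖deriv s u‖ ^ 2)⁻¹ •
        SpaceCurve.foot (iteratedDeriv 2 s u) (deriv s u) ≠ 0 :=
      smul_ne_zero (by norm_num) (norm_ne_zero_iff.1 (by rwa [hκ]))
    have h2 := SpaceCurve.tendsto_pow_nhdsNE (n := 2) (by norm_num)
    have hFne : ∀ᶠ ε in 𝓝[≠] 0, F ε ≠ 0 :=
      (tendsto_sub_nhds_zero_iff.1 (hF.trans_tendsto h2)).eventually_ne hF0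
    constructor
    · filter_upwards [hcirc, hFne] with ε hε hFε
      obtain ⟨-, hδ, h, hk⟩ := hε
      exact SpaceCurve.existsUnique_isDiscreteCurvatureCircle hFε hδ h hk
    · have hc := ((SpaceCurve.isBigO_comp_sub (SpaceCurve.differentiableAt_invert hF0) h2
        hF).const_smul_left (1 / 2 : ℝ)).add
          (hζ'.trans (SpaceCurve.isBigO_pow_of_le (show 2 ≤ 4 by norm_num)))
      refine hc.congr' ?_ EventuallyEq.rfl
      filter_upwards [hcirc, hFne] with ε hε hFε
      obtain ⟨-, hδ, h, hk⟩ := hε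
      rw [SpaceCurve.discreteCenter_eq hFε hδ h hk, ← hinv]
      simp only [Pi.smul_apply, smul_sub]
      abel
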